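/- **Setting.** $\mathbf{Cat}$ is the (1-)category of small categories, $s\mathbf{Cat}$ the category of small simplicially enriched categories and simplicial functors; $\mathbf{Cat}\subset s\mathbf{Cat}$ by viewing hom sets as discrete simplicial sets. Let $\mathtt{Ass}=\Delta^{\mathrm{op}}$, write $\mathbf{Cat}_{\mathtt{Ass}}$, $s\mathbf{Cat}_{\mathtt{Ass}}$ for the slice categories, and let $\Delta_{\mathtt{Ass}}\subset\mathbf{Cat}_{\mathtt{Ass}}$ be the full subcategory of the functors $[k]\to\mathtt{Ass}$, $k\ge 0$. For $X\in s\mathbf{Cat}$ let $\mathcal O_X\in s\mathbf{Cat}_{\mathtt{Ass}}$ be the category of operators of the simplicial multicategory whose objects are pairs $(u^{\mathbf x},u^{\mathbf y})$ of objects of $X$, with $$\mathcal O_X\big(u_1,\dots,u_n;v\big)=X(v^{\mathbf x},u_1^{\mathbf x})\times\prod_{i=1}^{n-1}X(u_i^{\mathbf y},u_{i+1}^{\mathbf x})\times X(u_n^{\mathbf y},v^{\mathbf y}),\qquad \mathcal O_X(\,;v)=X(v^{\mathbf x},v^{\mathbf y}),$$ and composition by substitution and composition in $X$. Thus the objects of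 $\mathcal O_X$ are finite sequences of pairs, and a morphism $(u_1,\dots,u_m)\to(v_1,\dots,v_n)$ is a monotone map $\varphi:[n]\to[m]$ together with multimorphisms $(u_{\varphi(i-1)+1},\dots,u_{\varphi(i)})\to v_i$ for $1\le i\le n$. This defines functors $\mathcal O:s\mathbf{Cat}\to s\mathbf{Cat}_{\mathtt{Ass}}$ and, by restriction, $\mathcal O:\mathbf{Cat}\to\mathbf{Cat}_{\mathtt{Ass}}$. Give $s\mathbf{Cat}$ the Bergner model structure, and $s\mathbf{Cat}_{\mathtt{Ass}}$ the slice structure (fibrations, cofibrations and weak equivalences are those of the underlying simplicial functors). **Proposition.** Let $\mathcal F:\Delta_{\mathtt{Ass}}\to\mathbf{Cat}$ be a functor with a formal adjunction $\mathrm{adj}:\mathcal F\dashv\mathcal O$ on classical categories, i.e. bijections $\mathbf{Cat}_{\mathtt{Ass}}(\sigma,\mathcal O_X)\cong\mathbf{Cat}(\mathcal F\sigma,X)$ natural in $\sigma\in\Delta_{\mathtt{Ass}}$ and $X\in\mathbf{Cat}$. Then: 1. $\mathcal O:s\mathbf{Cat}\to s\mathbf{Cat}_{\mathtt{Ass}}$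 preserves fibrations and weak equivalences. 2. $\mathcal F$ has a pointwise left Kan extension along $\Delta_{\mathtt{Ass}}\subset\mathbf{Cat}_{\mathtt{Ass}}$. For every left Kan extension $\hat{\mathcal F}:\mathbf{Cat}_{\mathtt{Ass}}\to\mathbf{Cat}$ of $\mathcal F$ there is a Quillen adjunction $\hat{\mathcal F}_\bullet:s\mathbf{Cat}_{\mathtt{Ass}}\rightleftarrows s\mathbf{Cat}:\mathcal O$ extending $\mathrm{adj}$, in which $\hat{\mathcal F}_\bullet$ is obtained by applying $\hat{\mathcal F}$ in each simplicial dimension. 3. The extension is unique. Here an extension of $\mathrm{adj}$ is a functor $L:s\mathbf{Cat}_{\mathtt{Ass}}\to s\mathbf{Cat}$ with a natural isomorphism $L|_{\Delta_{\mathtt{Ass}}}\cong\mathcal F$ and an adjunction $L\dashv\mathcal O$ which induces $\mathrm{adj}$ on $\Delta_{\mathtt{Ass}}$ and $\mathbf{Cat}$. If $L$ is the extension of part 2 and $L'$ is any extension, there is an isomorphism $L\cong L'$ compatible with the identifications with $\mathcal F$ and with the adjunctions, and it is the only isomorphism compatible with the identifications with $\mathcal F$, as well as the only one compatible with the adjunctions.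 In particular, for a given $L$ with $L|_{\Delta_{\mathtt{Ass}}}\cong\mathcal F$ at most one adjunction $L\dashv\mathcal O$ extends $\mathrm{adj}$. -/

import Mathlib

open CategoryTheory Opposite

universe u

namespace Algebroid

/-! ### Strings of morphisms and the multicategory attached to a category -/

/-- Let `u₀, …, u_{m-1}` be pairs of objects of `C`, written `uᵢ = (uᵢ.1, uᵢ.2)`. For `a ≤ b`,
`Str u a b c d` is the product of hom sets
`C(c, u_a.1) × C(u_a.2, u_{a+1}.1) × ⋯ × C(u_{b-2}.2, u_{b-1}.1) × C(u_{b-1}.2, d)`,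
which is `C(c, d)` if `a = b`. (It is empty if `b < a`.) This is the set of multimorphisms
`(u_a, …, u_{b-1}) ⟶ (c, d)` of the multicategory attached to `C`. -/
inductive Str {C : Type u} [Category.{u} C] {m : ℕ} (u : Fin m → C × C) :
    Fin (m + 1) → Fin (m + 1) → C → C → Type u
  | last {a : Fin (m + 1)} {c d : C} (f : c ⟶ d) : Str u a a c d
  | cons {b : Fin (m + 1)} {d : C} (i : Fin m) {c : C} (f : c ⟶ (u i).1)
      (t : Str u i.succ b (u i).2 d) : Str u i.castSucc b c d

namespace Str

section

variable {C : Type u} [Category.{u} C] {m n p : ℕ} {u : Fin m → C × C} {v : Fin n → C × C}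
  {w : Fin p → C × C}

/-- Compose a morphism with the first morphism of a string. -/
def pre {a b : Fin (m + 1)} {c' c d : C} (h : c' ⟶ c) : Str u a b c d → Str u a b c' d
  | last f => last (h ≫ f)
  | cons i f t => cons i (h ≫ f) t

/-- Concatenate two strings by composing the last morphism of the first string with the first
morphism of the second one. -/
def comp {a b e : Fin (m + 1)} {x y z : C} : Str u a b x y → Str u b e y z → Str u a e x z
  | last f, t => pre f t
  | cons i f s, t => cons i f (comp s t)

/-- Substitution of strings `fᵢ` between the consecutive morphisms of a string, followed by
composition in `C`: this is the composition law of the multicategory. -/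
def subst {φ : Fin (n + 1) → Fin (m + 1)}
    (f : ∀ i : Fin n, Str u (φ i.castSucc) (φ i.succ) (v i).1 (v i).2) {a b : Fin (n + 1)}
    {c d : C} : Str v a b c d → Str u (φ a) (φ b) c d
  | last g => last g
  | cons i g t => (pre g (f i)).comp (subst f t)

/-- The unit `uᵢ ⟶ uᵢ` of the multicategory. -/
def unit (u : Fin m → C × C) (i : Fin m) : Str u i.castSucc i.succ (u i).1 (u i).2 :=
  cons i (𝟙 _) (last (𝟙 _))

@[simp]
theorem pre_last {a : Fin (m + 1)} {c' c d : C} (h : c' ⟶ c) (f : c ⟶ d) :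
    pre h (last (u := u) (a := a) f) = last (h ≫ f) := rfl

@[simp]
theorem pre_cons {b : Fin (m + 1)} {c' c d : C} (i : Fin m) (h : c' ⟶ c) (f : c ⟶ (u i).1)
    (t : Str u i.succ b (u i).2 d) : pre h (cons i f t) = cons i (h ≫ f) t := rfl

@[simp]
theorem last_comp {a e : Fin (m + 1)} {x y z : C} (f : x ⟶ y) (t : Str u a e y z) :
    (last f).comp t = pre f t := rfl

@[simp]
theorem cons_comp {b e : Fin (m + 1)} {x y z : C} (i : Fin m) (f : x ⟶ (u i).1)
    (s : Str u i.succ b (u i).2 y) (t : Str u b e y z) :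
    (cons i f s).comp t = cons i f (s.comp t) := rfl

@[simp]
theorem pre_id {a b : Fin (m + 1)} {c d : C} (s : Str u a b c d) : pre (𝟙 c) s = s := by
  cases s <;> simp

@[simp]
theorem pre_pre {a b : Fin (m + 1)} {c₁ c₂ c d : C} (h : c₁ ⟶ c₂) (k : c₂ ⟶ c)
    (s : Str u a b c d) : pre h (pre k s) = pre (h ≫ k) s := by
  cases s <;> simp

@[simp]
theorem pre_comp {a b e : Fin (m + 1)} {x' x y z : C} (h : x' ⟶ x) (s : Str u a b x y)
    (t : Str u b e y z) : pre h (s.comp t) = (pre h s).comp t := by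
  cases s <;> simp

theorem comp_assoc {a b e e' : Fin (m + 1)} {x y z z' : C} (r : Str u a b x y)
    (s : Str u b e y z) (t : Str u e e' z z') : (r.comp s).comp t = r.comp (s.comp t) := by
  induction r with
  | last f => simp
  | cons i f r ih => simp [ih]

@[simp]
theorem comp_last_id {a b : Fin (m + 1)} {x y : C} (s : Str u a b x y) :
    s.comp (last (𝟙 y)) = s := by
  induction s with
  | last f => simp
  | cons i f r ih => simp [ih]

theorem subst_pre {φ : Fin (n + 1) → Fin (m + 1)}
    (f : ∀ i : Fin n, Str u (φ i.castSucc) (φ i.succ) (v i).1 (v i).2) {a b : Fin (n + 1)}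
    {c' c d : C} (h : c' ⟶ c) (s : Str v a b c d) : subst f (pre h s) = pre h (subst f s) := by
  cases s <;> simp [subst]

theorem subst_comp {φ : Fin (n + 1) → Fin (m + 1)}
    (f : ∀ i : Fin n, Str u (φ i.castSucc) (φ i.succ) (v i).1 (v i).2) {a b e : Fin (n + 1)}
    {x y z : C} (s : Str v a b x y) (t : Str v b e y z) :
    subst f (s.comp t) = (subst f s).comp (subst f t) := by
  induction s with
  | last g => simp [subst, subst_pre]
  | cons i g s ih => simp [subst, ih, comp_assoc]

theorem subst_unit {a b : Fin (m + 1)} {x y : C} (s : Str u a b x y) :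
    subst (φ := fun a => a) (unit u) s = s := by
  induction s with
  | last g => rfl
  | cons i g s ih => simp [subst, ih, unit]

theorem unit_subst {φ : Fin (n + 1) → Fin (m + 1)}
    (f : ∀ i : Fin n, Str u (φ i.castSucc) (φ i.succ) (v i).1 (v i).2) (i : Fin n) :
    subst f (unit v i) = f i := by
  simp [subst, unit]

theorem subst_subst {φ : Fin (n + 1) → Fin (m + 1)} {ψ : Fin (p + 1) → Fin (n + 1)}
    (f : ∀ i : Fin n, Str u (φ i.castSucc) (φ i.succ) (v i).1 (v i).2)
    (g : ∀ i : Fin p, Str v (ψ i.castSucc) (ψ i.succ) (w i).1 (w i).2) {a b : Fin (p + 1)}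
    {x y : C} (s : Str w a b x y) :
    subst f (subst g s) = subst (φ := fun a => φ (ψ a)) (fun i => subst f (g i)) s := by
  induction s with
  | last g => rfl
  | cons i h s ih => simp [subst, ih, subst_comp, subst_pre]

end

section

variable {C D E : Type u} [Category.{u} C] [Category.{u} D] [Category.{u} E] {m n : ℕ}

/-- The pairs `(G uᵢ.1, G uᵢ.2)`. -/
def mapSeq (G : C ⥤ D) (u : Fin m → C × C) (i : Fin m) : D × D :=
  (G.obj (u i).1, G.obj (u i).2)

/-- Apply a functor to all morphisms of a string. -/
def map (G : C ⥤ D) {u : Fin m → C × C} {a b : Fin (m + 1)} {c d : C} :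
    Str u a b c d → Str (mapSeq G u) a b (G.obj c) (G.obj d)
  | last f => last (G.map f)
  | cons i f t => cons i (G.map f) (map G t)

variable (G : C ⥤ D) {u : Fin m → C × C} {v : Fin n → C × C}

theorem map_pre {a b : Fin (m + 1)} {c' c d : C} (h : c' ⟶ c) (s : Str u a b c d) :
    map G (pre h s) = pre (G.map h) (map G s) := by
  cases s with
  | last f => simp [map]
  | cons i f t => simp only [map, pre_cons, Functor.map_comp]; rfl

theorem map_comp {a b e : Fin (m + 1)} {x y z : C} (s : Str u a b x y) (t : Str u b e y z) :
    map G (s.comp t) = (map G s).comp (map G t) := by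
  induction s with
  | last f => simp [map, map_pre]
  | cons i f s ih => simp only [map, cons_comp, ih]; rfl

theorem map_subst {φ : Fin (n + 1) → Fin (m + 1)}
    (f : ∀ i : Fin n, Str u (φ i.castSucc) (φ i.succ) (v i).1 (v i).2) {a b : Fin (n + 1)}
    {x y : C} (s : Str v a b x y) :
    map G (subst f s) =
      subst (u := mapSeq G u) (v := mapSeq G v) (fun i => map G (f i)) (map G s) := by
  induction s with
  | last f => rfl
  | cons i g s ih => simp only [subst, map, ih, map_comp, map_pre]; rfl

theorem map_unit (i : Fin m) : map G (unit u i) = unit (mapSeq G u) i := by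
  simp [unit, map, mapSeq]

theorem map_id {a b : Fin (m + 1)} {x y : C} (s : Str u a b x y) : map (𝟭 C) s = s := by
  induction s with
  | last f => rfl
  | cons i g s ih => exact congrArg (cons (u := u) i g) ih

theorem map_map (H : D ⥤ E) {a b : Fin (m + 1)} {x y : C} (s : Str u a b x y) :
    map H (map G s) = map (G ⋙ H) s := by
  induction s with
  | last f => rfl
  | cons i g s ih => exact congrArg (cons (u := mapSeq (G ⋙ H) u) i ((G ⋙ H).map g)) ih

end

end Str

/-! ### The category of operators -/

/-- The objects of the category of operators of the multicategory attached to `C`: finite sequences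
of pairs of objects of `C`. -/
structure OObj (C : Type u) : Type u where
  /-- The number of pairs in the sequence, as an object of the simplex category. -/
  len : SimplexCategory
  /-- The pairs in the sequence. -/
  seq : Fin len.len → C × C

/-- The morphisms `(u₀, …, u_{m-1}) ⟶ (v₀, …, v_{n-1})` of the category of operators: a morphism
`[m] ⟶ [n]` of `SimplexCategoryᵒᵖ`, that is a monotone map `φ : {0, …, n} → {0, …, m}`, and for
every `i` a multimorphism `(u_{φ(i)}, …, u_{φ(i+1)-1}) ⟶ vᵢ`. -/
structure OHom {C : Type u} [Category.{u} C] (U V : OObj C) : Type u where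
  /-- The underlying morphism of the simplex category. -/
  base : V.len ⟶ U.len
  /-- The multimorphisms. -/
  str : ∀ i : Fin V.len.len, Str U.seq (base.toOrderHom i.castSucc) (base.toOrderHom i.succ)
    (V.seq i).1 (V.seq i).2

namespace OHom

variable {C D E : Type u} [Category.{u} C] [Category.{u} D] [Category.{u} E]

/-- The identity of `U`. -/
def id (U : OObj C) : OHom U U where
  base := 𝟙 _
  str i := Str.unit U.seq i

/-- Composition in the category of operators. -/
def comp {U V W : OObj C} (f : OHom U V) (g : OHom V W) : OHom U W where
  base := g.base ≫ f.base
  str i := Str.subst (φ := f.base.toOrderHom) f.str (g.str i)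

/-- The action of a functor on objects of the category of operators. -/
def mapObj (G : C ⥤ D) (U : OObj C) : OObj D where
  len := U.len
  seq := Str.mapSeq G U.seq

/-- The action of a functor on morphisms of the category of operators. -/
def map (G : C ⥤ D) {U V : OObj C} (f : OHom U V) : OHom (mapObj G U) (mapObj G V) where
  base := f.base
  str i := Str.map G (f.str i)

theorem id_comp {U V : OObj C} (f : OHom U V) : comp (id U) f = f := by
  obtain ⟨φ, s⟩ := f
  have h : (id U).comp ⟨φ, s⟩ = ⟨φ ≫ 𝟙 _, s⟩ :=
    congrArg (OHom.mk (φ ≫ 𝟙 _)) (funext fun i => Str.subst_unit (s i))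
  rw [h]
  congr 1
  exact Category.comp_id φ

theorem comp_id {U V : OObj C} (f : OHom U V) : comp f (id V) = f := by
  obtain ⟨φ, s⟩ := f
  have h : comp ⟨φ, s⟩ (id V) = ⟨𝟙 _ ≫ φ, s⟩ :=
    congrArg (OHom.mk (U := U) (V := V) (𝟙 _ ≫ φ))
      (funext fun i => Str.unit_subst (φ := φ.toOrderHom) s i)
  rw [h]
  congr 1
  exact Category.id_comp φ

theorem assoc {U V W Z : OObj C} (f : OHom U V) (g : OHom V W) (h : OHom W Z) :
    comp (comp f g) h = comp f (comp g h) := by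
  obtain ⟨φ, s⟩ := f
  obtain ⟨ψ, t⟩ := g
  obtain ⟨χ, r⟩ := h
  exact congrArg (OHom.mk (χ ≫ ψ ≫ φ)) (funext fun i =>
    (Str.subst_subst (φ := φ.toOrderHom) (ψ := ψ.toOrderHom) s t (r i)).symm)

theorem map_id (G : C ⥤ D) (U : OObj C) : map G (id U) = id (mapObj G U) :=
  congrArg (OHom.mk (𝟙 _)) (funext fun i => Str.map_unit G (u := U.seq) i)

theorem map_comp (G : C ⥤ D) {U V W : OObj C} (f : OHom U V) (g : OHom V W) :
    map G (comp f g) = comp (map G f) (map G g) := by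
  obtain ⟨φ, s⟩ := f
  obtain ⟨ψ, t⟩ := g
  exact congrArg (OHom.mk (U := mapObj G U) (V := mapObj G W) (ψ ≫ φ)) (funext fun i =>
    Str.map_subst G (φ := φ.toOrderHom) s (t i))

theorem id_map {U V : OObj C} (f : OHom U V) : map (𝟭 C) f = f := by
  obtain ⟨φ, s⟩ := f
  exact congrArg (OHom.mk φ) (funext fun i => Str.map_id (s i))

theorem map_map (G : C ⥤ D) (H : D ⥤ E) {U V : OObj C} (f : OHom U V) :
    map H (map G f) = map (G ⋙ H) f := by
  obtain ⟨φ, s⟩ := f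
  exact congrArg (OHom.mk (U := mapObj (G ⋙ H) U) (V := mapObj (G ⋙ H) V) φ)
    (funext fun i => Str.map_map G H (s i))

end OHom

/-- The category of operators of the multicategory attached to `C`. -/
instance {C : Type u} [Category.{u} C] : Category.{u} (OObj C) where
  Hom := OHom
  id := OHom.id
  comp := OHom.comp
  id_comp := OHom.id_comp
  comp_id := OHom.comp_id
  assoc := OHom.assoc

/-- The functor from the category of operators to (a small copy of) the opposite of the simplex
category. -/
def OProj (C : Type u) [Category.{u} C] : OObj C ⥤ AsSmall.{u} SimplexCategoryᵒᵖ where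
  obj U := ULift.up (op U.len)
  map f := ULift.up (OHom.base f).op
  map_id _ := rfl
  map_comp _ _ := rfl

/-- The functor induced on categories of operators by a functor. -/
def OMap {C D : Type u} [Category.{u} C] [Category.{u} D] (G : C ⥤ D) : OObj C ⥤ OObj D where
  obj := OHom.mapObj G
  map f := OHom.map G f
  map_id := OHom.map_id G
  map_comp := OHom.map_comp G

/-- The associative operad: the category `SimplexCategoryᵒᵖ`. -/
def Ass : Cat.{u, u} := Cat.of (AsSmall.{u} SimplexCategoryᵒᵖ)

/-- The functor which sends a small category `C` to the category of operators of its multicategory,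
as a category over `Ass`. -/
def O : Cat.{u, u} ⥤ Over Ass.{u} where
  obj C := Over.mk (Y := Cat.of (OObj C)) (OProj C).toCatHom
  map G := Over.homMk (OMap G.toFunctor).toCatHom rfl
  map_id C := by
    ext1
    exact congrArg Functor.toCatHom
      (Functor.hext (fun U => rfl) (fun U V f => heq_of_eq (OHom.id_map f)))
  map_comp G H := by
    ext1
    exact congrArg Functor.toCatHom
      (Functor.hext (fun U => rfl)
        (fun U V f => heq_of_eq (OHom.map_map G.toFunctor H.toFunctor f).symm))

/-! ### Simplicial categories -/

/-- A small category enriched in simplicial sets. -/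
structure SCat : Type (u + 1) where
  /-- The type of objects. -/
  carrier : Type u
  /-- The enriched category structure. -/
  [str : EnrichedCategory SSet.{u} carrier]

namespace SCat

open MonoidalCategory

/-- A pair of simplices, as a simplex of the product. -/
def pair (A B : SSet.{u}) {k : SimplexCategoryᵒᵖ} (x : A.obj k) (y : B.obj k) :
    (A ⊗ B : SSet.{u}).obj k := (x, y)

theorem enrichedFunctor_ext {C D : Type u} [EnrichedCategory SSet.{u} C]
    [EnrichedCategory SSet.{u} D] {F G : EnrichedFunctor SSet.{u} C D} (h : F.obj = G.obj)
    (h' : HEq F.map G.map) : F = G := by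
  cases F
  cases G
  cases h
  cases h'
  rfl

attribute [instance] SCat.str

/-- The category `sCat` of small simplicially enriched categories and simplicial functors. -/
instance : Category.{u} SCat.{u} where
  Hom X Y := EnrichedFunctor SSet.{u} X.carrier Y.carrier
  id X := EnrichedFunctor.id SSet X.carrier
  comp F G := EnrichedFunctor.comp SSet F G
  id_comp _ := enrichedFunctor_ext rfl (heq_of_eq (funext₂ fun _ _ => Category.id_comp _))
  comp_id _ := enrichedFunctor_ext rfl (heq_of_eq (funext₂ fun _ _ => Category.comp_id _))
  assoc _ _ _ :=
    enrichedFunctor_ext rfl (heq_of_eq (funext₂ fun _ _ => Category.assoc _ _ _))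

/-- The objects of the category of `k`-simplices of a simplicial category `X`. -/
def Level (X : SCat.{u}) (_ : SimplexCategoryᵒᵖ) : Type u := X.carrier

/-- The category of `k`-simplices of `X`: the objects are those of `X` and the morphisms are the
`k`-simplices of the simplicial sets of morphisms of `X`. -/
instance (X : SCat.{u}) (k : SimplexCategoryᵒᵖ) : Category.{u} (Level X k) where
  Hom a b := (X.str.Hom a b).obj k
  id a := (eId SSet (C := X.carrier) a).app k PUnit.unit
  comp {a b c} f g := (eComp SSet (C := X.carrier) a b c).app k (pair (X.str.Hom a b) (X.str.Hom b c) f g)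
  id_comp {a b} f := ConcreteCategory.congr_hom (C := Type u)
    (NatTrans.congr_app (e_id_comp SSet (C := X.carrier) a b) k) f
  comp_id {a b} f := ConcreteCategory.congr_hom (C := Type u)
    (NatTrans.congr_app (e_comp_id SSet (C := X.carrier) a b) k) f
  assoc {a b c d} f g h := ConcreteCategory.congr_hom (C := Type u)
    (NatTrans.congr_app (e_assoc SSet (C := X.carrier) a b c d) k) 
    (pair (X.str.Hom a b) (X.str.Hom b c ⊗ X.str.Hom c d) f (pair (X.str.Hom b c) (X.str.Hom c d) g h))

/-- The functor on categories of simplices induced by a simplicial operator. -/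
def levelOp (X : SCat.{u}) {k l : SimplexCategoryᵒᵖ} (θ : k ⟶ l) : Level X k ⥤ Level X l where
  obj a := a
  map {a b} f := (X.str.Hom a b).map θ f
  map_id a := (ConcreteCategory.congr_hom (C := Type u)
    ((eId SSet (C := X.carrier) a).naturality θ) PUnit.unit).symm
  map_comp {a b c} f g := (ConcreteCategory.congr_hom (C := Type u)
    ((eComp SSet (C := X.carrier) a b c).naturality θ) (pair (X.str.Hom a b) (X.str.Hom b c) f g)).symm

/-- The functor on categories of `k`-simplices induced by a simplicial functor. -/
def levelMap {X Y : SCat.{u}} (F : X ⟶ Y) (k : SimplexCategoryᵒᵖ) : Level X k ⥤ Level Y k where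
  obj a := EnrichedFunctor.obj (C := X.carrier) (D := Y.carrier) F a
  map {a b} f := (EnrichedFunctor.map (C := X.carrier) (D := Y.carrier) F a b).app k f
  map_id a := ConcreteCategory.congr_hom (C := Type u)
    (NatTrans.congr_app (EnrichedFunctor.map_id (C := X.carrier) (D := Y.carrier) F a) k) PUnit.unit
  map_comp {a b c} f g := ConcreteCategory.congr_hom (C := Type u)
    (NatTrans.congr_app (EnrichedFunctor.map_comp (C := X.carrier) (D := Y.carrier) F a b c) k) (pair (X.str.Hom a b) (X.str.Hom b c) f g)




theorem levelOp_id (X : SCat.{u}) (k : SimplexCategoryᵒᵖ) : levelOp X (𝟙 k) = 𝟭 (Level X k) :=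
  Functor.hext (fun _ => rfl) (fun a b f => heq_of_eq (ConcreteCategory.congr_hom (C := Type u)
    ((X.str.Hom a b).map_id k) f))

theorem levelOp_comp (X : SCat.{u}) {k l m : SimplexCategoryᵒᵖ} (θ : k ⟶ l) (η : l ⟶ m) :
    levelOp X (θ ≫ η) = levelOp X θ ⋙ levelOp X η :=
  Functor.hext (fun _ => rfl) (fun a b f => heq_of_eq (ConcreteCategory.congr_hom (C := Type u)
    ((X.str.Hom a b).map_comp θ η) f))

theorem levelOp_levelMap {X Y : SCat.{u}} (F : X ⟶ Y) {k l : SimplexCategoryᵒᵖ} (θ : k ⟶ l) :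
    levelOp X θ ⋙ levelMap F l = levelMap F k ⋙ levelOp Y θ :=
  Functor.hext (fun _ => rfl) (fun a b f => heq_of_eq (ConcreteCategory.congr_hom (C := Type u)
    ((EnrichedFunctor.map (C := X.carrier) (D := Y.carrier) F a b).naturality θ) f))

/-- The simplicial category as a simplicial object in the category of small categories. -/
def levels : SCat.{u} ⥤ SimplicialObject Cat.{u, u} where
  obj X :=
    { obj k := Cat.of (Level X k)
      map θ := (levelOp X θ).toCatHom
      map_id k := congrArg Functor.toCatHom (levelOp_id X k)
      map_comp θ η := congrArg Functor.toCatHom (levelOp_comp X θ η) }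
  map F :=
    { app k := (levelMap F k).toCatHom
      naturality _ _ θ := congrArg Functor.toCatHom (levelOp_levelMap F θ) }
  map_id _ := rfl
  map_comp _ _ := rfl

/-- Construct a simplicial category from its simplices of morphisms. -/
def ofLevels {C : Type u} (H : C → C → SSet.{u}) (one : ∀ k a, (H a a).obj k)
    (mul : ∀ k {a b c : C}, (H a b).obj k → (H b c).obj k → (H a c).obj k)
    (map_one : ∀ {k l} (θ : k ⟶ l) (a : C), (H a a).map θ (one k a) = one l a)
    (map_mul : ∀ {k l} (θ : k ⟶ l) {a b c : C} (f : (H a b).obj k) (g : (H b c).obj k),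
      (H a c).map θ (mul k f g) = mul l ((H a b).map θ f) ((H b c).map θ g))
    (one_mul : ∀ k {a b : C} (f : (H a b).obj k), mul k (one k a) f = f)
    (mul_one : ∀ k {a b : C} (f : (H a b).obj k), mul k f (one k b) = f)
    (mul_assoc : ∀ k {a b c d : C} (f : (H a b).obj k) (g : (H b c).obj k) (h : (H c d).obj k),
      mul k (mul k f g) h = mul k f (mul k g h)) : SCat.{u} where
  carrier := C
  str :=
    { Hom := H
      id a :=
        { app k := ↾fun _ => one k a
          naturality k l θ := by
            ext x
            exact (map_one θ a).symm }
      comp a b c :=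
        { app k := ↾fun p : (H a b).obj k × (H b c).obj k => mul k p.1 p.2
          naturality k l θ := by
            ext ⟨f, g⟩
            exact (map_mul θ f g).symm }
      id_comp a b := by
        ext k f
        exact one_mul k f
      comp_id a b := by
        ext k f
        exact mul_one k f
      assoc a b c d := by
        ext k ⟨f, g, h⟩
        exact mul_assoc k f g h }

/-- A category, viewed as a simplicial category with discrete simplicial sets of morphisms. -/
def discrete : Cat.{u, u} ⥤ SCat.{u} where
  obj C := ofLevels (C := C) (fun a b => (Functor.const _).obj (a ⟶ b)) (fun _ a => 𝟙 a)
    (fun _ _ _ _ f g => f ≫ g) (fun _ _ => rfl) (fun _ _ _ _ _ _ => rfl)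
    (fun _ _ _ f => Category.id_comp f) (fun _ _ _ f => Category.comp_id f)
    (fun _ _ _ _ _ f g h => Category.assoc f g h)
  map G :=
    { obj a := G.toFunctor.obj a
      map a b := (Functor.const _).map (↾fun f => G.toFunctor.map f)
      map_id a := by
        ext k x
        exact G.toFunctor.map_id a
      map_comp a b c := by
        ext k ⟨f, g⟩
        exact G.toFunctor.map_comp f g }
  map_id _ := rfl
  map_comp _ _ := rfl

/-- The isomorphism from a category to the category of `k`-simplices of the associated discrete
simplicial category. -/
def toDiscreteLevel (C : Cat.{u, u}) (k : SimplexCategoryᵒᵖ) : C ⥤ Level (discrete.obj C) k where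
  obj a := a
  map f := f

/-- The inverse of `toDiscreteLevel`. -/
def ofDiscreteLevel (C : Cat.{u, u}) (k : SimplexCategoryᵒᵖ) : Level (discrete.obj C) k ⥤ C where
  obj a := a
  map f := f
  map_id _ := rfl
  map_comp _ _ := rfl

/-- The categories of simplices of a discrete simplicial category. -/
def discreteLevels : discrete.{u} ⋙ levels ≅ Functor.const _ :=
  NatIso.ofComponents (fun C => NatIso.ofComponents (fun k =>
    { hom := (ofDiscreteLevel C k).toCatHom
      inv := (toDiscreteLevel C k).toCatHom
      hom_inv_id := rfl
      inv_hom_id := rfl }) (fun _ => rfl)) (fun _ => rfl)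

end SCat

/-! ### The simplicial category of operators -/

/-- The category `Ass`, viewed as a discrete simplicial category. -/
abbrev sAss : SCat.{u} := SCat.discrete.obj Ass

/-- The operator `Str.map` induced by a simplicial operator on morphisms of operators. -/
def opMap (X : SCat.{u}) {k l : SimplexCategoryᵒᵖ} (θ : k ⟶ l) {U V : OObj X.carrier}
    (f : OHom (C := SCat.Level X k) U V) : OHom (C := SCat.Level X l) U V :=
  OHom.map (SCat.levelOp X θ) f

/-- The simplicial category of operators of the simplicial multicategory attached to a simplicial
category `X`. Its objects are the finite sequences of pairs of objects of `X`. As the products and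
coproducts of simplicial sets are formed dimension by dimension, the `k`-simplices of morphisms are
the morphisms of the category of operators attached to the category of `k`-simplices of `X`. -/
def sOObj (X : SCat.{u}) : SCat.{u} :=
  SCat.ofLevels (C := OObj X.carrier)
    (fun U V =>
      { obj k := OHom (C := SCat.Level X k) U V
        map θ := ↾(opMap X θ)
        map_id k := by
          ext f
          exact (congrArg (fun G : SCat.Level X k ⥤ SCat.Level X k =>
            HEq (OHom.map G f) f) (SCat.levelOp_id X k)) |>.mpr
              (heq_of_eq (OHom.id_map (C := SCat.Level X k) f)) |> eq_of_heq
        map_comp {k l m} θ η := by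
          ext f
          exact (congrArg (fun G : SCat.Level X k ⥤ SCat.Level X m =>
            HEq (OHom.map G f) (opMap X η (opMap X θ f))) (SCat.levelOp_comp X θ η)) |>.mpr
              (heq_of_eq (OHom.map_map (SCat.levelOp X θ) (SCat.levelOp X η) f).symm)
              |> eq_of_heq })
    (fun k U => OHom.id (C := SCat.Level X k) U)
    (fun k _ _ _ f g => OHom.comp (C := SCat.Level X k) f g)
    (fun θ U => OHom.map_id (SCat.levelOp X θ) U)
    (fun θ _ _ _ f g => OHom.map_comp (SCat.levelOp X θ) f g)
    (fun k _ _ f => OHom.id_comp (C := SCat.Level X k) f)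
    (fun k _ _ f => OHom.comp_id (C := SCat.Level X k) f)
    (fun k _ _ _ _ f g h => OHom.assoc (C := SCat.Level X k) f g h)

/-- The projection of the simplicial category of operators to `Ass`. -/
def sOProj (X : SCat.{u}) : sOObj X ⟶ sAss.{u} where
  obj U := ULift.up (op (OObj.len (C := X.carrier) U))
  map _ _ :=
    { app k := ↾fun f => ULift.up (OHom.base (C := SCat.Level X k) f).op
      naturality _ _ _ := rfl }
  map_id _ := rfl
  map_comp _ _ _ := rfl

/-- The simplicial functor induced on simplicial categories of operators. -/
def sOMap {X Y : SCat.{u}} (F : X ⟶ Y) : sOObj X ⟶ sOObj Y where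
  obj U := OHom.mapObj (C := SCat.Level X (op (.mk 0))) (D := SCat.Level Y (op (.mk 0)))
    (SCat.levelMap F _) U
  map U V :=
    { app k := ↾fun f => OHom.map (SCat.levelMap F k) f
      naturality k l θ := by
        ext f
        have h := (OHom.map_map (SCat.levelOp X θ) (SCat.levelMap F l) f)
        have h' := (OHom.map_map (SCat.levelMap F k) (SCat.levelOp Y θ) f)
        have e : HEq (OHom.map (SCat.levelOp X θ ⋙ SCat.levelMap F l) f)
            (OHom.map (SCat.levelMap F k ⋙ SCat.levelOp Y θ) f) := by
          rw [SCat.levelOp_levelMap]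
        exact eq_of_heq ((heq_of_eq h).trans (e.trans (heq_of_eq h'.symm))) }
  map_id U := by
    ext k x
    exact OHom.map_id (SCat.levelMap F k) U
  map_comp U V W := by
    ext k ⟨f, g⟩
    exact OHom.map_comp (SCat.levelMap F k) f g

/-- The functor `O` from simplicial categories to simplicial categories over `Ass`. -/
def sO : SCat.{u} ⥤ Over sAss.{u} where
  obj X := Over.mk (sOProj X)
  map F := Over.homMk (sOMap F) rfl
  map_id X := by
    ext1
    refine SCat.enrichedFunctor_ext rfl (heq_of_eq (funext₂ fun U V => ?_))
    ext k f
    exact OHom.id_map (C := SCat.Level X k) f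
  map_comp {X Y Z} F G := by
    ext1
    refine SCat.enrichedFunctor_ext rfl (heq_of_eq (funext₂ fun U V => ?_))
    ext k f
    exact (OHom.map_map (SCat.levelMap F k) (SCat.levelMap G k) f).symm

/-- On discrete simplicial categories, `sO` restricts to `O`: the isomorphism is the identity on
objects and on morphisms. -/
def discreteO : O.{u} ⋙ Over.post SCat.discrete ≅ SCat.discrete ⋙ sO :=
  NatIso.ofComponents (fun C => Over.isoMk
    { hom :=
        { obj U := U
          map U V :=
            { app k := ↾fun f => OHom.map (SCat.toDiscreteLevel C k) f
              naturality k l θ := by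
                ext f
                exact (OHom.map_map (SCat.toDiscreteLevel C k)
                  (SCat.levelOp (SCat.discrete.obj C) θ) f).symm }
          map_id U := by
            ext k f
            exact OHom.map_id (SCat.toDiscreteLevel C k) U
          map_comp U V W := by
            ext k ⟨f, g⟩
            exact OHom.map_comp (SCat.toDiscreteLevel C k) f g }
      inv :=
        { obj U := U
          map U V :=
            { app k := ↾fun f => OHom.map (SCat.ofDiscreteLevel C k) f
              naturality k l θ := by
                ext f
                exact OHom.map_map (SCat.levelOp (SCat.discrete.obj C) θ)
                  (SCat.ofDiscreteLevel C l) f }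
          map_id U := by
            ext k f
            exact OHom.map_id (SCat.ofDiscreteLevel C k) U
          map_comp U V W := by
            ext k ⟨f, g⟩
            exact OHom.map_comp (SCat.ofDiscreteLevel C k) f g }
      hom_inv_id := by
        refine SCat.enrichedFunctor_ext rfl (heq_of_eq (funext₂ fun U V => ?_))
        ext k f
        exact (OHom.map_map (SCat.toDiscreteLevel C k) (SCat.ofDiscreteLevel C k) f).trans
          (OHom.id_map f)
      inv_hom_id := by
        refine SCat.enrichedFunctor_ext rfl (heq_of_eq (funext₂ fun U V => ?_))
        ext k f
        exact (OHom.map_map (SCat.ofDiscreteLevel C k) (SCat.toDiscreteLevel C k) f).trans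
          (OHom.id_map f) } rfl) (fun {C D} G => by
    ext1
    refine SCat.enrichedFunctor_ext rfl (heq_of_eq (funext₂ fun U V => ?_))
    ext k f
    exact (OHom.map_map G.toFunctor (SCat.toDiscreteLevel D k) f).trans
      (OHom.map_map (SCat.toDiscreteLevel C k) (SCat.levelMap (SCat.discrete.map G) k) f).symm)

/-! ### The model structures -/

section Homotopy

open HomotopicalAlgebra

/-- Weak equivalences of simplicial sets: the maps `f : A ⟶ B` which induce bijections between
homotopy classes of maps `[B, K] → [A, K]` for every Kan complex `K`. -/
def weakEq : MorphismProperty SSet.{u} := fun A B f =>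
  ∀ K : SSet.{u}, SSet.KanComplex K →
    (∀ g : A ⟶ K, ∃ h : B ⟶ K, Nonempty (SSet.Homotopy (f ≫ h) g)) ∧
    ∀ h h' : B ⟶ K, Nonempty (SSet.Homotopy (f ≫ h) (f ≫ h')) → Nonempty (SSet.Homotopy h h')

namespace SCat

/-- A `0`-simplex `f` of the simplicial set of morphisms `a ⟶ b` is a homotopy equivalence if it
becomes an isomorphism in the category of components of `X`, whose morphisms are the connected
components of the simplicial sets of morphisms of `X`. -/
def IsHomotopyEquiv (X : SCat.{u}) {a b : Level X (op (.mk 0))} (f : a ⟶ b) : Prop :=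
  ∃ g : b ⟶ a,
    SSet.π₀.mk (X := X.str.Hom a a) (f ≫ g) = SSet.π₀.mk (X := X.str.Hom a a) (𝟙 a) ∧
    SSet.π₀.mk (X := X.str.Hom b b) (g ≫ f) = SSet.π₀.mk (X := X.str.Hom b b) (𝟙 b)

/-- The weak equivalences of the Bergner model structure: the simplicial functors which induce weak
equivalences on simplicial sets of morphisms and which are essentially surjective on categories of
components. -/
instance : CategoryWithWeakEquivalences SCat.{u} where
  weakEquivalences X Y F :=
    (∀ a b : X.carrier, weakEq (EnrichedFunctor.map (C := X.carrier) (D := Y.carrier) F a b)) ∧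
    ∀ b : Level Y (op (.mk 0)), ∃ (a : Level X (op (.mk 0)))
      (e : (levelMap F (op (.mk 0))).obj a ⟶ b), IsHomotopyEquiv Y e

/-- The fibrations of the Bergner model structure: the simplicial functors which induce Kan
fibrations on simplicial sets of morphisms and which have the lifting property for homotopy
equivalences. -/
instance : CategoryWithFibrations SCat.{u} where
  fibrations X Y F :=
    (∀ a b : X.carrier, SSet.modelCategoryQuillen.J.rlp
      (EnrichedFunctor.map (C := X.carrier) (D := Y.carrier) F a b)) ∧
    ∀ (a : Level X (op (.mk 0))) (b : Level Y (op (.mk 0)))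
      (e : (levelMap F (op (.mk 0))).obj a ⟶ b), IsHomotopyEquiv Y e →
      ∃ (a' : Level X (op (.mk 0))) (d : a ⟶ a') (h : (levelMap F (op (.mk 0))).obj a' = b),
        IsHomotopyEquiv X d ∧ (levelMap F (op (.mk 0))).map d ≫ eqToHom h = e

/-- The cofibrations of the Bergner model structure: the simplicial functors which have the left
lifting property with respect to the fibrations which are weak equivalences. -/
instance : CategoryWithCofibrations SCat.{u} where
  cofibrations := (trivialFibrations SCat.{u}).llp

end SCat

/-- An adjunction `L ⊣ R` is a Quillen adjunction if `L` preserves cofibrations and `R` preserves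
fibrations and trivial fibrations. (For model categories each of the three classical conditions
`L` preserves cofibrations and trivial cofibrations, `R` preserves fibrations and trivial fibrations,
`L` preserves cofibrations and `R` preserves fibrations, is equivalent to this.) -/
structure IsQuillenAdjunction {M N : Type*} [Category* M] [Category* N]
    [CategoryWithCofibrations M] [CategoryWithFibrations M] [CategoryWithWeakEquivalences M]
    [CategoryWithCofibrations N] [CategoryWithFibrations N] [CategoryWithWeakEquivalences N]
    {L : M ⥤ N} {R : N ⥤ M} (_ : L ⊣ R) : Prop where
  left_cofibrations : cofibrations M ≤ (cofibrations N).inverseImage L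
  right_fibrations : fibrations N ≤ (fibrations M).inverseImage R
  right_trivialFibrations : trivialFibrations N ≤ (trivialFibrations M).inverseImage R

end Homotopy

/-! ### Formal adjunctions -/

/-- Let `ι : C ⥤ C'`, `L : C ⥤ D` and `R : D ⥤ C'` be functors (`ι` being usually the inclusion of
a full subcategory). A formal adjunction between `L` and `R` is a bijection
`C'(ι c, R d) ≃ D(L c, d)`, natural in `c` and `d`. -/
structure FormalAdjunction {C C' D : Type*} [Category* C] [Category* C'] [Category* D]
    (ι : C ⥤ C') (L : C ⥤ D) (R : D ⥤ C') where
  /-- The bijection. -/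
  homEquiv (c : C) (d : D) : (L.obj c ⟶ d) ≃ (ι.obj c ⟶ R.obj d)
  naturality_left {c c' : C} (f : c ⟶ c') {d : D} (g : L.obj c' ⟶ d) :
    homEquiv c d (L.map f ≫ g) = ι.map f ≫ homEquiv c' d g
  naturality_right {c : C} {d d' : D} (g : L.obj c ⟶ d) (h : d ⟶ d') :
    homEquiv c d' (g ≫ h) = homEquiv c d g ≫ R.map h

/-- The functor which sends `[n]` to the poset `{0, …, n}`, viewed as a small category. -/
def simplex : SimplexCategory ⥤ Cat.{u, u} := SimplexCategory.toCat ⋙ Cat.asSmallFunctor.{u}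

/-- The category of simplices of `Ass`: its objects are the functors `{0, …, n} ⥤ Ass`. -/
abbrev SimplexAss : Type u := CostructuredArrow simplex.{u} Ass.{u}

/-- The fully faithful inclusion of the category of simplices of `Ass` in the slice category. -/
abbrev simplexInclusion : SimplexAss.{u} ⥤ Over Ass.{u} := CostructuredArrow.toOver simplex Ass

/-- Categories over `Ass`, viewed as discrete simplicial categories over `Ass`. -/
abbrev discreteOver : Over Ass.{u} ⥤ Over sAss.{u} := Over.post SCat.discrete

/-- A simplicial category over `Ass`, viewed as a simplicial object in categories over `Ass`. -/
def levelsOver : Over sAss.{u} ⥤ SimplicialObject (Over Ass.{u}) where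
  obj S := Over.lift (SCat.levels.obj S.left)
    (SCat.levels.map S.hom ≫ SCat.discreteLevels.hom.app Ass)
  map {S T} f :=
    { app k := Over.homMk ((SCat.levels.map f.left).app k) (congrArg
        (fun g => (SCat.levels.map g ≫ SCat.discreteLevels.hom.app Ass).app k) (Over.w f))
      naturality k l θ := by
        ext1
        exact (SCat.levels.map f.left).naturality θ }

/-- The dimensions of a discrete simplicial category over `Ass`. -/
def discreteOverLevel (S : Over Ass.{u}) (k : SimplexCategoryᵒᵖ) :
    S ≅ (levelsOver.obj (discreteOver.obj S)).obj k :=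
  Over.isoMk ((SCat.discreteLevels.symm.app S.left).app k) rfl

/-- An extension of a formal adjunction `adj` between `F` and `O` to an adjunction between
simplicial categories over `Ass` and simplicial categories: a functor `functor` whose restriction to
the simplices of `Ass` is identified with `F`, and an adjunction `functor ⊣ sO` which restricts
to `adj` along the inclusion of categories in simplicial categories. -/
structure Extension {F : SimplexAss.{u} ⥤ Cat.{u, u}}
    (adj : FormalAdjunction simplexInclusion F O.{u}) where
  /-- The left adjoint. -/
  functor : Over sAss.{u} ⥤ SCat.{u}
  /-- The restriction of the left adjoint to the simplices of `Ass`. -/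
  restriction : simplexInclusion ⋙ discreteOver ⋙ functor ≅ F ⋙ SCat.discrete
  /-- The adjunction. -/
  adjunction : functor ⊣ sO
  extends_adj (σ : SimplexAss.{u}) (X : Cat.{u, u}) (g : F.obj σ ⟶ X) :
    adjunction.homEquiv _ _ (restriction.hom.app σ ≫ SCat.discrete.map g) =
      discreteOver.map (adj.homEquiv σ X g) ≫ discreteO.hom.app X

/-- An isomorphism between the left adjoints of two extensions is compatible with their
identifications with `F`. -/
def Extension.RespectsRestriction {F : SimplexAss.{u} ⥤ Cat.{u, u}}
    {adj : FormalAdjunction simplexInclusion F O.{u}} {E E' : Extension adj}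
    (θ : E.functor ≅ E'.functor) : Prop :=
  ∀ σ : SimplexAss.{u}, θ.hom.app (discreteOver.obj (simplexInclusion.obj σ)) ≫
    E'.restriction.hom.app σ = E.restriction.hom.app σ

/-- An isomorphism between the left adjoints of two extensions is compatible with the
adjunctions. -/
def Extension.RespectsAdjunction {F : SimplexAss.{u} ⥤ Cat.{u, u}}
    {adj : FormalAdjunction simplexInclusion F O.{u}} {E E' : Extension adj}
    (θ : E.functor ≅ E'.functor) : Prop :=
  ∀ (S : Over sAss.{u}) (X : SCat.{u}) (g : E'.functor.obj S ⟶ X),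
    E.adjunction.homEquiv S X (θ.hom.app S ≫ g) = E'.adjunction.homEquiv S X g

/-- Let `Fhat`, with `η : F ⟶ simplexInclusion ⋙ Fhat`, be a functor on categories over `Ass`. An
identification of the left adjoint of an extension with the application of `Fhat` in each
dimension, compatible with the identifications of both functors on the simplices of `Ass`. -/
structure Extension.Levelwise {F : SimplexAss.{u} ⥤ Cat.{u, u}}
    {adj : FormalAdjunction simplexInclusion F O.{u}} (E : Extension adj)
    {Fhat : Over Ass.{u} ⥤ Cat.{u, u}} (η : F ⟶ simplexInclusion ⋙ Fhat) where
  /-- The isomorphism `(L S)ₖ ≅ Fhat (Sₖ)`, natural in `S` and `k`. -/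
  iso : E.functor ⋙ SCat.levels ≅ levelsOver ⋙ (SimplicialObject.whiskering _ _).obj Fhat
  compat (σ : SimplexAss.{u}) (k : SimplexCategoryᵒᵖ) :
    (SCat.levels.map (E.restriction.hom.app σ)).app k ≫
        (SCat.discreteLevels.hom.app (F.obj σ)).app k ≫ η.app σ =
      (iso.hom.app (discreteOver.obj (simplexInclusion.obj σ))).app k ≫
        Fhat.map (discreteOverLevel (simplexInclusion.obj σ) k).inv

end Algebroid

/-! Fibrations and weak equivalences. A mapping space of `sO X` is a coproduct, over monotone maps,
of finite products of mapping spaces of `X`. Kan fibrations and weak equivalences are both stable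
under isomorphisms, finite products and coproducts (`IsProdSigmaStable`), so the local conditions
pass from `F` to `sO F` (`sOMap_map_mem`). For the conditions on objects, the projection to the
discrete `Ass` forces a homotopy equivalence of `sO X` to lie over an isomorphism of the simplex
category, hence over an identity. It is therefore a family of homotopy equivalences of `X`,
contravariant in the first members of the pairs and covariant in the second ones
(`exists_of_isHomotopyEquiv`). The contravariant members require lifts with prescribed target
(`exists_lift_target`).

Existence. The simplices are dense in categories over `Ass` because the nerve is fully faithful
(`denseAt_simplexInclusion`), so the pointwise left Kan extension `Fhat` is an honest left adjoint
of `O` (`FormalAdjunction.exists_adjunction`). Simplicial categories are the simplicial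
categories-objects whose operators are bijective on objects. To apply `Fhat` dimensionwise, it must
preserve functors that are bijective on objects; mapping into codiscrete categories shows this
(`obj_bijective_of_adjunction`). The dimensionwise adjunction then restricts to one between
`leftFunctor` and `sO`, and it is Quillen by the first paragraph.

Uniqueness. Adjoints of `sO` are unique up to a unique isomorphism compatible with the adjunctions,
and this isomorphism respects the restrictions, since both adjunctions induce `adj`. The remaining
claim is that an endomorphism of the left adjoint that is trivial on simplices is the identity. Its
conjugate is an endomorphism `β` of `sO` which is trivial on maps out of simplices, and these detect
only dimension `0`. Higher simplices are reached by naturality: each `k`-simplex of morphisms of `sO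
X` lifts to `sO (bip X k)`, where simplices are determined by their vertices, so that `β` is trivial
there (`levelMap_eq_id_of_natTrans`). -/

namespace Algebroid

/-! ### Closure properties of weak equivalences and Kan fibrations of simplicial sets. -/

section SSet

open MonoidalCategory CartesianMonoidalCategory Simplicial HomotopicalAlgebra

/-! ### Homotopies into Kan complexes -/

/-- The existence of a homotopy between two maps of simplicial sets. -/
def Homotopic {A K : SSet.{u}} (f g : A ⟶ K) : Prop := Nonempty (SSet.Homotopy f g)

theorem homotopic_iff {A K : SSet.{u}} (f g : A ⟶ K) :
    Homotopic f g ↔ ∃ H : A ⊗ Δ[1] ⟶ K, SSet.ι₀ ≫ H = f ∧ SSet.ι₁ ≫ H = g := by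
  constructor
  · rintro ⟨H⟩
    exact ⟨H.h, H.h₀, H.h₁⟩
  · rintro ⟨H, h₀, h₁⟩
    -- The remaining field is a condition on the empty subcomplex.
    refine ⟨⟨H, h₀, h₁, ?_⟩⟩
    ext k ⟨⟨x, hx⟩, y⟩
    exact hx.elim

theorem Homotopic.refl {A K : SSet.{u}} (f : A ⟶ K) : Homotopic f f :=
  (homotopic_iff _ _).2 ⟨fst _ _ ≫ f, by simp [← Category.assoc], by simp [← Category.assoc]⟩

theorem Homotopic.precomp {A B K : SSet.{u}} {f g : B ⟶ K} (h : Homotopic f g) (p : A ⟶ B) :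
    Homotopic (p ≫ f) (p ≫ g) := by
  rw [homotopic_iff] at h ⊢
  obtain ⟨H, rfl, rfl⟩ := h
  exact ⟨p ▷ _ ≫ H, by simp, by simp⟩

theorem whiskerLeft_δ_one (A : SSet.{u}) :
    A ◁ SSet.stdSimplex.δ (1 : Fin 2) = fst A Δ[0] ≫ SSet.ι₀ := by
  rw [SSet.stdSimplex.δ_one_eq_const]
  rfl

theorem whiskerLeft_δ_zero (A : SSet.{u}) :
    A ◁ SSet.stdSimplex.δ (0 : Fin 2) = fst A Δ[0] ≫ SSet.ι₁ := by
  rw [SSet.stdSimplex.δ_zero_eq_const]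
  rfl

/-- Homotopies are edges of the simplicial set of maps. -/
theorem homotopic_iff_curry {A K : SSet.{u}} (f g : A ⟶ K) :
    Homotopic f g ↔ ∃ e : Δ[1] ⟶ (ihom A).obj K,
      SSet.stdSimplex.δ 1 ≫ e = MonoidalClosed.curry (fst A Δ[0] ≫ f) ∧
      SSet.stdSimplex.δ 0 ≫ e = MonoidalClosed.curry (fst A Δ[0] ≫ g) := by
  rw [homotopic_iff]
  -- The projection `A ⊗ Δ[0] ⟶ A` has a section.
  have hA : Function.Injective (fun f : A ⟶ K => fst A Δ[0] ≫ f) := fun f g h => by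
    have := congrArg (fun t => lift (𝟙 A) (SSet.const (SSet.stdSimplex.obj₀Equiv.symm 0)) ≫ t) h
    simpa [← Category.assoc] using this
  constructor
  · rintro ⟨H, rfl, rfl⟩
    refine ⟨MonoidalClosed.curry H, ?_, ?_⟩
    · rw [← MonoidalClosed.curry_natural_left, whiskerLeft_δ_one, Category.assoc]
    · rw [← MonoidalClosed.curry_natural_left, whiskerLeft_δ_zero, Category.assoc]
  · rintro ⟨e, h₀, h₁⟩
    obtain ⟨H, rfl⟩ : ∃ H, e = MonoidalClosed.curry H :=
      ⟨MonoidalClosed.uncurry e, (MonoidalClosed.curry_uncurry e).symm⟩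
    rw [← MonoidalClosed.curry_natural_left] at h₀ h₁
    replace h₀ := MonoidalClosed.curry_injective h₀
    replace h₁ := MonoidalClosed.curry_injective h₁
    rw [whiskerLeft_δ_one, Category.assoc] at h₀
    rw [whiskerLeft_δ_zero, Category.assoc] at h₁
    exact ⟨H, hA h₀, hA h₁⟩

theorem Homotopic.trans {A K : SSet.{u}} [SSet.KanComplex K] {f g h : A ⟶ K}
    (h₁ : Homotopic f g) (h₂ : Homotopic g h) : Homotopic f h := by
  rw [homotopic_iff_curry] at h₁ h₂ ⊢
  obtain ⟨e₁, h₁, h₁'⟩ := h₁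
  obtain ⟨e₂, h₂, h₂'⟩ := h₂
  -- An inner horn of dimension `2` in the internal hom, which is a Kan complex: `e₁` is the face
  -- opposite to `2` and `e₂` the face opposite to `0`. The face of a filler opposite to `1` is the
  -- composite homotopy.
  let F : ∀ (j : Fin 3) (_ : j ≠ 1), Δ[1] ⟶ (ihom A).obj K := fun j _ => if j = 0 then e₂ else e₁
  have hF : SSet.horn.IsCompatible F := by
    rw [SSet.horn.isCompatible_iff]
    intro j k hj hk hjk
    obtain rfl : j = 0 := by fin_cases j <;> fin_cases k <;> simp_all
    obtain rfl : k = 2 := by fin_cases k <;> simp_all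
    exact h₂.trans h₁'.symm
  obtain ⟨φ, hφ⟩ := hF.exists_lift_of_kanComplex
  have hφ₀ : SSet.stdSimplex.δ 0 ≫ φ = e₂ := hφ 0 (by decide)
  have hφ₂ : SSet.stdSimplex.δ 2 ≫ φ = e₁ := hφ 2 (by decide)
  refine ⟨SSet.stdSimplex.δ 1 ≫ φ, ?_, ?_⟩
  · rw [← h₁, ← hφ₂, ← Category.assoc, ← Category.assoc]
    congr 1
    exact (SSet.stdSimplex.δ_comp_δ (i := (1 : Fin 2)) (j := 1) le_rfl).symm
  · rw [← h₂', ← hφ₀, ← Category.assoc, ← Category.assoc]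
    exact congrArg (· ≫ φ) (SSet.stdSimplex.δ_comp_δ (i := (0 : Fin 2)) (j := 0) le_rfl)

theorem weakEq.comp {A B C : SSet.{u}} {f : A ⟶ B} {g : B ⟶ C} (hf : weakEq f) (hg : weakEq g) :
    weakEq (f ≫ g) := fun K hK => by
  constructor
  · intro k
    obtain ⟨h, hh⟩ := (hf K hK).1 k
    obtain ⟨h', hh'⟩ := (hg K hK).1 h
    refine ⟨h', ?_⟩
    rw [Category.assoc]
    exact Homotopic.trans (Homotopic.precomp hh' f) hh
  · intro h h' H
    rw [Category.assoc, Category.assoc] at H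
    exact (hg K hK).2 _ _ ((hf K hK).2 _ _ H)

theorem weakEq_of_isIso {A B : SSet.{u}} (f : A ⟶ B) [IsIso f] : weakEq f := fun K hK => by
  constructor
  · intro g
    exact ⟨inv f ≫ g, by rw [IsIso.hom_inv_id_assoc]; exact Homotopic.refl g⟩
  · intro h h' H
    have := Homotopic.precomp H (inv f)
    rwa [IsIso.inv_hom_id_assoc, IsIso.inv_hom_id_assoc] at this

instance : weakEq.{u}.RespectsIso :=
  MorphismProperty.RespectsIso.mk _ (fun e _ hf => (weakEq_of_isIso e.hom).comp hf)
    (fun e _ hf => hf.comp (weakEq_of_isIso e.hom))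

theorem homotopic_curry_iff {Z A K : SSet.{u}} (f g : Z ⊗ A ⟶ K) :
    Homotopic f g ↔ Homotopic (MonoidalClosed.curry f) (MonoidalClosed.curry g) := by
  rw [homotopic_iff, homotopic_iff]
  constructor
  · rintro ⟨H, rfl, rfl⟩
    refine ⟨MonoidalClosed.curry ((α_ _ _ _).inv ≫ H), ?_, ?_⟩ <;>
    · rw [← MonoidalClosed.curry_natural_left]
      rfl
  · rintro ⟨H, h₀, h₁⟩
    obtain ⟨H, rfl⟩ : ∃ H', H = MonoidalClosed.curry H' :=
      ⟨MonoidalClosed.uncurry H, (MonoidalClosed.curry_uncurry H).symm⟩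
    rw [← MonoidalClosed.curry_natural_left] at h₀ h₁
    exact ⟨(α_ _ _ _).hom ≫ H, MonoidalClosed.curry_injective h₀,
      MonoidalClosed.curry_injective h₁⟩

/-- By currying, homotopy classes of maps from `Z ⊗ A` to `K` are those from `A` to the internal hom
from `Z` to `K`, which is again a Kan complex. -/
theorem weakEq.whiskerLeft {A B : SSet.{u}} {f : A ⟶ B} (hf : weakEq f) (Z : SSet.{u}) :
    weakEq (Z ◁ f) := fun K hK => by
  constructor
  · intro g
    obtain ⟨h, hh⟩ := (hf ((ihom Z).obj K) inferInstance).1 (MonoidalClosed.curry g)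
    refine ⟨MonoidalClosed.uncurry h, ?_⟩
    have := (homotopic_curry_iff (Z ◁ f ≫ MonoidalClosed.uncurry h) g).2
    rw [MonoidalClosed.curry_natural_left, MonoidalClosed.curry_uncurry] at this
    exact this hh
  · intro h h' H
    refine (homotopic_curry_iff _ _).2 ((hf ((ihom Z).obj K) inferInstance).2 _ _ ?_)
    rw [← MonoidalClosed.curry_natural_left, ← MonoidalClosed.curry_natural_left]
    exact (homotopic_curry_iff _ _).1 H

theorem weakEq.tensorHom {A B A' B' : SSet.{u}} {f : A ⟶ B} {f' : A' ⟶ B'} (hf : weakEq f)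
    (hf' : weakEq f') : weakEq (f ⊗ₘ f') := by
  rw [MonoidalCategory.tensorHom_def]
  refine weakEq.comp ?_ (hf'.whiskerLeft _)
  have : f ▷ A' = (β_ _ _).hom ≫ A' ◁ f ≫ (β_ _ _).inv := by simp
  rw [this]
  exact (weakEq_of_isIso _).comp ((hf.whiskerLeft _).comp (weakEq_of_isIso _))

/-! ### Coproducts of simplicial sets -/

/-- The coproduct of a family of simplicial sets. -/
def sigmaSSet {I : Type} (A : I → SSet.{u}) : SSet.{u} where
  obj k := Σ i, (A i).obj k
  map θ := ↾fun x => ⟨x.1, (A x.1).map θ x.2⟩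
  map_id k := by
    refine ConcreteCategory.hom_ext _ _ fun x => ?_
    exact congrArg (Sigma.mk (β := fun i => (A i).obj k) x.1) (ConcreteCategory.congr_hom ((A x.1).map_id k) x.2)
  map_comp {_ _ m} θ η := by
    refine ConcreteCategory.hom_ext _ _ fun x => ?_
    exact congrArg (Sigma.mk (β := fun i => (A i).obj m) x.1) (ConcreteCategory.congr_hom ((A x.1).map_comp θ η) x.2)

/-- The inclusion of a summand in a coproduct of simplicial sets. -/
def sigmaIncl {I : Type} (A : I → SSet.{u}) (i : I) : A i ⟶ sigmaSSet A where
  app _ := ↾fun x => ⟨i, x⟩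
  naturality _ _ _ := rfl

/-- The map between coproducts induced by a family of maps. -/
def sigmaMap {I : Type} {A B : I → SSet.{u}} (f : ∀ i, A i ⟶ B i) :
    sigmaSSet A ⟶ sigmaSSet B where
  app k := ↾fun x => ⟨x.1, (f x.1).app k x.2⟩
  naturality k l θ := by
    refine ConcreteCategory.hom_ext _ _ fun x => ?_
    exact congrArg (Sigma.mk (β := fun i => (B i).obj l) x.1) (ConcreteCategory.congr_hom ((f x.1).naturality θ) x.2)

/-- The map from a coproduct with given components. -/
def sigmaDesc {I : Type} {A : I → SSet.{u}} {K : SSet.{u}} (f : ∀ i, A i ⟶ K) :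
    sigmaSSet A ⟶ K where
  app k := ↾fun x => (f x.1).app k x.2
  naturality k l θ := by
    ext x
    exact ConcreteCategory.congr_hom ((f x.1).naturality θ) x.2

/-- Homotopies can be defined on each summand of a coproduct. -/
theorem homotopic_of_sigma {I : Type} {A : I → SSet.{u}} {K : SSet.{u}} {f g : sigmaSSet A ⟶ K}
    (h : ∀ i, Homotopic (sigmaIncl A i ≫ f) (sigmaIncl A i ≫ g)) : Homotopic f g := by
  simp only [homotopic_iff] at h ⊢
  choose H h₀ h₁ using h
  refine ⟨{ app k := ↾fun x => (H x.1.1).app k (SCat.pair (A x.1.1) Δ[1] x.1.2 x.2), naturality := ?_ }, ?_, ?_⟩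
  · intro k l θ
    ext x
    exact ConcreteCategory.congr_hom ((H x.1.1).naturality θ) (SCat.pair (A x.1.1) Δ[1] x.1.2 x.2)
  · ext k x
    exact ConcreteCategory.congr_hom (NatTrans.congr_app (h₀ x.1) k) x.2
  · ext k x
    exact ConcreteCategory.congr_hom (NatTrans.congr_app (h₁ x.1) k) x.2

/-- Maps and homotopies out of a coproduct can be chosen on each summand separately. -/
theorem weakEq.sigmaMap {I : Type} {A B : I → SSet.{u}} {f : ∀ i, A i ⟶ B i}
    (hf : ∀ i, weakEq (f i)) : weakEq (sigmaMap f) := fun K hK => by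
  constructor
  · intro g
    choose h hh using fun i => (hf i K hK).1 (sigmaIncl A i ≫ g)
    exact ⟨sigmaDesc h, homotopic_of_sigma hh⟩
  · intro h h' H
    exact homotopic_of_sigma fun i => (hf i K hK).2 _ _ (Homotopic.precomp H (sigmaIncl A i))

/-- A map to a coproduct with constant index factors through a summand. -/
theorem exists_factor_sigmaIncl {I : Type} {A : I → SSet.{u}} {T : SSet.{u}} (t : T ⟶ sigmaSSet A)
    (i : I) (h : ∀ k (x : T.obj k), (t.app k x).1 = i) : ∃ t' : T ⟶ A i, t' ≫ sigmaIncl A i = t := by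
  have h' : ∀ k (x : T.obj k), ∃ y : (A i).obj k, (⟨i, y⟩ : Σ i, (A i).obj k) = t.app k x := by
    intro k x
    have := h k x
    generalize t.app k x = z at this ⊢
    obtain ⟨j, y⟩ := z
    obtain rfl : j = i := this
    exact ⟨y, rfl⟩
  choose s hs using h'
  refine ⟨{ app k := ↾(s k), naturality := ?_ }, ?_⟩
  · intro k l θ
    ext x
    have h₁ := ConcreteCategory.congr_hom (t.naturality θ) x
    have h₂ : (⟨i, s l (T.map θ x)⟩ : Σ i, (A i).obj l) = ⟨i, (A i).map θ (s k x)⟩ := by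
      rw [hs]
      refine h₁.trans ?_
      exact congrArg ((sigmaSSet A).map θ) (hs k x).symm
    exact eq_of_heq (Sigma.mk.inj h₂).2
  · ext k x
    exact hs k x

/-- A simplex of a coproduct lies in one summand, so every lifting problem of a horn against
`sigmaMap f` is a lifting problem against a single `f c`. -/
theorem rlp_J_sigmaMap {I : Type} {A B : I → SSet.{u}} {f : ∀ i, A i ⟶ B i}
    (hf : ∀ i, SSet.modelCategoryQuillen.J.rlp (f i)) :
    SSet.modelCategoryQuillen.J.rlp (sigmaMap f) := by
  intro S T j hj
  have hj' := hj
  simp only [SSet.modelCategoryQuillen.J, MorphismProperty.iSup_iff] at hj'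
  obtain ⟨n, ⟨i⟩⟩ := hj'
  refine ⟨fun {t b} sq => ?_⟩
  -- Every simplex in the image of `b` is obtained from `x` by a simplicial operator, and operators
  -- preserve the index of the summand; commutativity of the square gives the same index for `t`.
  let x := SSet.yonedaEquiv b
  have hb : ∀ k (y : (Δ[n + 1] : SSet.{u}).obj k), (b.app k y).1 = x.1 := by
    intro k y
    have : b.app k y = (sigmaSSet B).map (SSet.stdSimplex.objEquiv y).op x := by
      conv_lhs => rw [← SSet.yonedaEquiv.symm_apply_apply b]
      rfl
    rw [this]
    rfl
  have ht : ∀ k (y : (Λ[n + 1, i] : SSet.{u}).obj k), (t.app k y).1 = x.1 := by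
    intro k y
    have := ConcreteCategory.congr_hom (NatTrans.congr_app sq.w k) y
    exact (congrArg Sigma.fst this).trans (hb k _)
  obtain ⟨t', ht'⟩ := exists_factor_sigmaIncl t _ ht
  obtain ⟨b', hb'⟩ := exists_factor_sigmaIncl b _ hb
  generalize x.1 = c at t' b' ht' hb'
  clear ht hb x
  subst ht' hb'
  have := hf c _ hj
  have sq' : CommSq t' Λ[n + 1, i].ι (f c) b' := ⟨by
    ext k y
    have := ConcreteCategory.congr_hom (NatTrans.congr_app sq.w k) y
    exact eq_of_heq (Sigma.mk.inj this).2⟩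
  refine ⟨⟨⟨sq'.lift ≫ sigmaIncl A c, ?_, ?_⟩⟩⟩
  · rw [← Category.assoc, sq'.fac_left]
  · rw [Category.assoc, show sigmaIncl A c ≫ sigmaMap f = f c ≫ sigmaIncl B c from rfl,
      ← Category.assoc, sq'.fac_right]

theorem rlp_tensorHom {W : MorphismProperty SSet.{u}} {A B A' B' : SSet.{u}} {f : A ⟶ B}
    {f' : A' ⟶ B'} (hf : W.rlp f) (hf' : W.rlp f') : W.rlp (f ⊗ₘ f') := by
  intro S T j hj
  have := hf j hj
  have := hf' j hj
  refine ⟨fun {t b} sq => ?_⟩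
  have sq₁ : CommSq (t ≫ fst _ _) j f (b ≫ fst _ _) := ⟨by simp [← sq.w_assoc]⟩
  have sq₂ : CommSq (t ≫ snd _ _) j f' (b ≫ snd _ _) := ⟨by simp [← sq.w_assoc]⟩
  exact ⟨⟨⟨lift sq₁.lift sq₂.lift, by ext1 <;> simp, by ext1 <;> simp⟩⟩⟩

/-! ### Properties of maps inherited by categories of operators -/

/-- Properties of maps of simplicial sets which are stable under isomorphisms, binary products and
coproducts. -/
class IsProdSigmaStable (W : MorphismProperty SSet.{u}) : Prop extends W.RespectsIso where
  of_isIso {A B : SSet.{u}} (f : A ⟶ B) [IsIso f] : W f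
  tensorHom {A B A' B' : SSet.{u}} {f : A ⟶ B} {f' : A' ⟶ B'} : W f → W f' → W (f ⊗ₘ f')
  sigmaMap {I : Type} {A B : I → SSet.{u}} {f : ∀ i, A i ⟶ B i} : (∀ i, W (f i)) → W (sigmaMap f)

instance : IsProdSigmaStable weakEq.{u} where
  of_isIso := weakEq_of_isIso
  tensorHom := weakEq.tensorHom
  sigmaMap := weakEq.sigmaMap

instance : IsProdSigmaStable SSet.modelCategoryQuillen.J.{u}.rlp where
  of_isIso f _ := MorphismProperty.rlp_of_isIso _ f
  tensorHom := rlp_tensorHom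
  sigmaMap := rlp_J_sigmaMap

/-- A property stable under isomorphisms can be transported along dimensionwise bijections. -/
theorem of_equiv (W : MorphismProperty SSet.{u}) [W.RespectsIso] {A B A' B' : SSet.{u}}
    {f : A ⟶ B} {f' : A' ⟶ B'} (hf : W f) (i : A ⟶ A') (j : B ⟶ B') (w : i ≫ f' = f ≫ j)
    (hi : ∀ k, Function.Bijective (i.app k)) (hj : ∀ k, Function.Bijective (j.app k)) : W f' := by
  have : ∀ k, IsIso (i.app k) := fun k => (isIso_iff_bijective _).2 (hi k)
  have : ∀ k, IsIso (j.app k) := fun k => (isIso_iff_bijective _).2 (hj k)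
  have := NatIso.isIso_of_isIso_app i
  have := NatIso.isIso_of_isIso_app j
  exact (W.arrow_mk_iso_iff (Arrow.isoMk (f := Arrow.mk f) (g := Arrow.mk f') (asIso i) (asIso j)
    w)).1 hf

/-- The product of a finite family of simplicial sets. -/
def piSSet {n : ℕ} (A : Fin n → SSet.{u}) : SSet.{u} where
  obj k := ∀ i, (A i).obj k
  map θ := ↾fun x i => (A i).map θ (x i)
  map_id k := by
    ext x i
    exact ConcreteCategory.congr_hom ((A i).map_id k) (x i)
  map_comp θ η := by
    ext x i
    exact ConcreteCategory.congr_hom ((A i).map_comp θ η) (x i)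

/-- The product of a finite family of maps of simplicial sets. -/
def piMap {n : ℕ} {A B : Fin n → SSet.{u}} (f : ∀ i, A i ⟶ B i) : piSSet A ⟶ piSSet B where
  app k := ↾fun x i => (f i).app k (x i)
  naturality k l θ := by
    ext x
    exact funext fun i => ConcreteCategory.congr_hom ((f i).naturality θ) (x i)

/-- Add a factor to a finite product of simplicial sets. -/
def piCons {n : ℕ} (A : Fin (n + 1) → SSet.{u}) :
    A 0 ⊗ piSSet (fun i => A i.succ) ⟶ piSSet A where
  app k := ↾fun x => Fin.cons x.1 x.2
  naturality k l θ := by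
    ext x
    refine funext fun i => ?_
    induction i using Fin.cases <;> rfl

theorem piMap_mem (W : MorphismProperty SSet.{u}) [IsProdSigmaStable W] {n : ℕ}
    {A B : Fin n → SSet.{u}} (f : ∀ i, A i ⟶ B i) (hf : ∀ i, W (f i)) : W (piMap f) := by
  induction n with
  | zero =>
    have : IsIso (piMap f) := by
      have : ∀ k, IsIso ((piMap f).app k) := fun k => (isIso_iff_bijective _).2
        ⟨fun x y _ => funext fun i => i.elim0, fun y => ⟨fun i => i.elim0, funext fun i => i.elim0⟩⟩
      exact NatIso.isIso_of_isIso_app _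
    exact IsProdSigmaStable.of_isIso _
  | succ n ih =>
    have hb : ∀ (A : Fin (n + 1) → SSet.{u}) k, Function.Bijective ((piCons A).app k) := fun A k =>
      (Fin.consEquiv (fun i => (A i).obj k)).bijective
    refine of_equiv W (IsProdSigmaStable.tensorHom (hf 0) (ih (fun i => f i.succ)
      fun i => hf i.succ)) (piCons A) (piCons B) ?_ (hb A) (hb B)
    ext k x
    refine funext fun i => ?_
    induction i using Fin.cases <;> rfl

end SSet

end Algebroid

/-! ### Mapping spaces of categories of operators as coproducts of products. -/

namespace Algebroid

/-! ### Simplicial sets of strings -/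

namespace Str

variable {C : Type u} [Category.{u} C] {m : ℕ} {u : Fin m → C × C}

theorem le {a b : Fin (m + 1)} {c d : C} (s : Str u a b c d) : a ≤ b := by
  induction s with
  | last f => exact le_rfl
  | cons i f t ih => exact (Fin.castSucc_lt_succ).le.trans ih

theorem last_bijective (a : Fin (m + 1)) (c d : C) :
    Function.Bijective (fun f : c ⟶ d => last (u := u) (a := a) f) := by
  constructor
  · intro f g h
    simpa using h
  -- The two ends are given separate names so that cases on `s` are possible; a string built with
  -- `cons` strictly increases the index, contradicting `a = b`.
  · suffices ∀ {a b : Fin (m + 1)} {c d : C} (s : Str u a b c d) (h : a = b),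
        ∃ f, (last (u := u) (a := a) f : Str u a a c d) = h ▸ s from fun s => this s rfl
    intro a b c d s h
    cases s with
    | last f => exact ⟨f, rfl⟩
    | cons i f t =>
      subst h
      exact absurd t.le (not_le_of_gt Fin.castSucc_lt_succ)

theorem cons_bijective (i : Fin m) (b : Fin (m + 1)) (h : b ≠ i.castSucc) (c d : C) :
    Function.Bijective (fun p : (c ⟶ (u i).1) × Str u i.succ b (u i).2 d =>
      cons (u := u) i p.1 p.2) := by
  constructor
  · rintro ⟨f, s⟩ ⟨g, t⟩ h
    simpa using h
  · suffices ∀ {a b : Fin (m + 1)} {c d : C} (s : Str u a b c d) (i : Fin m)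
        (e : a = i.castSucc) (_ : b ≠ i.castSucc),
        ∃ p : (c ⟶ (u i).1) × Str u i.succ b (u i).2 d, cons (u := u) i p.1 p.2 = e ▸ s from
      fun s => this s i rfl h
    intro a b c d s i e h
    cases s with
    | last f => exact absurd e h
    | cons j f t =>
      obtain rfl : j = i := Fin.castSucc_injective _ e
      exact ⟨(f, t), rfl⟩

end Str

section

open MonoidalCategory SCat

variable {X Y : SCat.{u}} {m : ℕ}

/-- The simplicial set of strings of a simplicial category. -/
def strSSet (X : SCat.{u}) (u : Fin m → X.carrier × X.carrier) (a b : Fin (m + 1))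
    (c d : X.carrier) : SSet.{u} where
  obj k := Str (C := Level X k) u a b c d
  map θ := ↾fun s => Str.map (levelOp X θ) s
  map_id k := by
    refine ConcreteCategory.hom_ext _ _ fun s => ?_
    exact (congrArg (fun G : Level X k ⥤ Level X k =>
      HEq (Str.map G s) s) (levelOp_id X k)) |>.mpr
        (heq_of_eq (Str.map_id (C := Level X k) s)) |> eq_of_heq
  map_comp {k l n} θ η := by
    refine ConcreteCategory.hom_ext _ _ fun s => ?_
    exact (congrArg (fun G : Level X k ⥤ Level X n =>
      HEq (Str.map G s) (Str.map (levelOp X η) (Str.map (levelOp X θ) s)))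
        (levelOp_comp X θ η)) |>.mpr
        (heq_of_eq (Str.map_map (levelOp X θ) (levelOp X η) s).symm) |> eq_of_heq

/-- The action of a simplicial functor on objects. -/
abbrev objMap (F : X ⟶ Y) (a : X.carrier) : Y.carrier :=
  EnrichedFunctor.obj (C := X.carrier) (D := Y.carrier) F a

/-- The image of a sequence of pairs under a simplicial functor. -/
abbrev seqMap (F : X ⟶ Y) (u : Fin m → X.carrier × X.carrier) : Fin m → Y.carrier × Y.carrier :=
  fun i => (objMap F (u i).1, objMap F (u i).2)

/-- The map of simplicial sets of strings induced by a simplicial functor. -/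
def strMap (F : X ⟶ Y) (u : Fin m → X.carrier × X.carrier) (a b : Fin (m + 1))
    (c d : X.carrier) : strSSet X u a b c d ⟶
      strSSet Y (seqMap F u) a b (objMap F c) (objMap F d) where
  app k := ↾fun s => Str.map (levelMap F k) s
  naturality k l θ := by
    refine ConcreteCategory.hom_ext _ _ fun s => ?_
    have e : HEq (Str.map (levelOp X θ ⋙ levelMap F l) s)
        (Str.map (levelMap F k ⋙ levelOp Y θ) s) := by
      rw [levelOp_levelMap]
    exact eq_of_heq ((heq_of_eq (Str.map_map (levelOp X θ) (levelMap F l) s)).trans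
      (e.trans (heq_of_eq (Str.map_map (levelMap F k) (levelOp Y θ) s).symm)))

/-- Strings with one morphism. -/
def strLast (X : SCat.{u}) (u : Fin m → X.carrier × X.carrier) (a : Fin (m + 1))
    (c d : X.carrier) : X.str.Hom c d ⟶ strSSet X u a a c d where
  app k := ↾fun f => Str.last (C := Level X k) (u := u) f
  naturality _ _ _ := rfl

/-- Strings with at least two morphisms. -/
def strCons (X : SCat.{u}) (u : Fin m → X.carrier × X.carrier) (i : Fin m) (b : Fin (m + 1))
    (c d : X.carrier) : X.str.Hom c (u i).1 ⊗ strSSet X u i.succ b (u i).2 d ⟶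
      strSSet X u i.castSucc b c d where
  app k := ↾fun p => Str.cons (C := Level X k) (u := u) i p.1 p.2
  naturality _ _ _ := rfl

theorem strLast_bijective (X : SCat.{u}) (u : Fin m → X.carrier × X.carrier) (a : Fin (m + 1))
    (c d : X.carrier) (k : SimplexCategoryᵒᵖ) : Function.Bijective ((strLast X u a c d).app k) :=
  Str.last_bijective (C := Level X k) (u := u) a c d

theorem strCons_bijective (X : SCat.{u}) (u : Fin m → X.carrier × X.carrier) (i : Fin m)
    (b : Fin (m + 1)) (h : b ≠ i.castSucc) (c d : X.carrier) (k : SimplexCategoryᵒᵖ) :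
    Function.Bijective ((strCons X u i b c d).app k) :=
  Str.cons_bijective (C := Level X k) (u := u) i b h c d

/-- Descending induction on `a`: strings from `a` to `b` form a mapping space if `a = b`, the
product of a mapping space with the strings from `a + 1` to `b` if `a < b`, and the empty simplicial
set if `b < a`. -/
theorem strMap_mem (W : MorphismProperty SSet.{u}) [IsProdSigmaStable W] (F : X ⟶ Y)
    (hF : ∀ a b : X.carrier, W (F.map a b)) (u : Fin m → X.carrier × X.carrier)
    (a b : Fin (m + 1)) (c d : X.carrier) : W (strMap F u a b c d) := by
  have hlast (a : Fin (m + 1)) (c d : X.carrier) : W (strMap F u a a c d) :=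
    of_equiv W (hF c d) (strLast X u a c d) (strLast Y (seqMap F u) a (objMap F c) (objMap F d))
      rfl (strLast_bijective X u a c d) (strLast_bijective Y (seqMap F u) a _ _)
  rcases lt_trichotomy a b with h | rfl | h
  · induction a using Fin.reverseInduction generalizing c with
    | last => exact absurd h (not_lt_of_ge (Fin.le_last b))
    | cast i ih =>
      have ht : W (strMap F u i.succ b (u i).2 d) := by
        rcases (Fin.castSucc_lt_iff_succ_le.1 h).lt_or_eq with h' | rfl
        · exact ih _ h'
        · exact hlast _ _ _
      exact of_equiv W (IsProdSigmaStable.tensorHom (hF c (u i).1) ht) (strCons X u i b c d)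
        (strCons Y (seqMap F u) i b (objMap F c) (objMap F d)) rfl
        (strCons_bijective X u i b h.ne' c d) (strCons_bijective Y (seqMap F u) i b h.ne' _ _)
  · exact hlast _ _ _
  · have : IsIso (strMap F u a b c d) := by
      have : ∀ k, IsIso ((strMap F u a b c d).app k) := fun k => (isIso_iff_bijective _).2
        ⟨fun x _ _ => absurd (Str.le x) (not_le_of_gt h),
          fun y => absurd (Str.le y) (not_le_of_gt h)⟩
      exact NatIso.isIso_of_isIso_app _
    exact IsProdSigmaStable.of_isIso _

/-- The simplicial set of morphisms of the category of operators, as a coproduct of products. -/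
def homSigma (X : SCat.{u}) (U V : OObj X.carrier) : SSet.{u} :=
  sigmaSSet fun φ : V.len ⟶ U.len => piSSet fun i : Fin V.len.len =>
    strSSet X U.seq (φ.toOrderHom i.castSucc) (φ.toOrderHom i.succ) (V.seq i).1 (V.seq i).2

/-- The comparison between the two descriptions of the simplicial set of morphisms. -/
def ofHomSigma (X : SCat.{u}) (U V : OObj X.carrier) : homSigma X U V ⟶ (sOObj X).str.Hom U V where
  app k := ↾fun x => OHom.mk (C := Level X k) x.1 x.2
  naturality _ _ _ := rfl

theorem ofHomSigma_bijective (X : SCat.{u}) (U V : OObj X.carrier) (k : SimplexCategoryᵒᵖ) :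
    Function.Bijective ((ofHomSigma X U V).app k) := by
  constructor
  · rintro ⟨φ, x⟩ ⟨ψ, y⟩ h
    obtain ⟨rfl, h⟩ := OHom.mk.inj h
    obtain rfl := eq_of_heq h
    rfl
  · rintro ⟨φ, x⟩
    exact ⟨⟨φ, x⟩, rfl⟩

/-- The image of an object of the category of operators under a simplicial functor. -/
abbrev oobjMap (F : X ⟶ Y) (U : OObj X.carrier) : OObj Y.carrier := objMap (sOMap F) U

/-- The comparison between the two descriptions of the map induced by a simplicial functor. -/
def homSigmaMap (F : X ⟶ Y) (U V : OObj X.carrier) :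
    homSigma X U V ⟶ homSigma Y (oobjMap F U) (oobjMap F V) :=
  sigmaMap fun φ => piMap fun i =>
    strMap F U.seq (φ.toOrderHom i.castSucc) (φ.toOrderHom i.succ) (V.seq i).1 (V.seq i).2

theorem sOMap_map_mem (W : MorphismProperty SSet.{u}) [IsProdSigmaStable W] (F : X ⟶ Y)
    (hF : ∀ a b : X.carrier, W (F.map a b)) (U V : OObj X.carrier) :
    W (EnrichedFunctor.map (C := (sOObj X).carrier) (D := (sOObj Y).carrier) (sOMap F) U V) := by
  have h : W (homSigmaMap F U V) := IsProdSigmaStable.sigmaMap fun φ => piMap_mem W _ fun i =>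
    strMap_mem W F hF U.seq (φ.toOrderHom i.castSucc) (φ.toOrderHom i.succ)
      (V.seq i).1 (V.seq i).2
  exact of_equiv W h (ofHomSigma X U V) (ofHomSigma Y (oobjMap F U) (oobjMap F V)) rfl
    (ofHomSigma_bijective X U V) (ofHomSigma_bijective Y _ _)

end

end Algebroid

/-! ### Homotopy equivalences in categories of operators, and the conditions on objects in the
Bergner structure. -/

namespace Algebroid

section Components

open MonoidalCategory CartesianMonoidalCategory Simplicial HomotopicalAlgebra SSet

open scoped SSet.modelCategoryQuillen

/-! ### Connected components -/

theorem π₀_mk_app {A B : SSet.{u}} (f : A ⟶ B) {x y : A _⦋0⦌} (h : π₀.mk x = π₀.mk y) :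
    π₀.mk (f.app _ x) = π₀.mk (f.app _ y) := by
  rw [← mapπ₀_mk, ← mapπ₀_mk, h]

theorem π₀_mk_of_app {A B : SSet.{u}} (f : A ⟶ B) (hf : ∀ k, Function.Bijective (f.app k))
    {x y : A _⦋0⦌} (h : π₀.mk (f.app _ x) = π₀.mk (f.app _ y)) : π₀.mk x = π₀.mk y := by
  have : ∀ k, IsIso (f.app k) := fun k => (isIso_iff_bijective _).2 (hf k)
  have := NatIso.isIso_of_isIso_app f
  have h' := congrArg (mapπ₀ (inv f)) h
  rwa [← mapπ₀_mk, ← mapπ₀_mk, ← mapπ₀_comp_apply, ← mapπ₀_comp_apply, IsIso.hom_inv_id,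
    mapπ₀_id_apply, mapπ₀_id_apply] at h'

theorem const_app_zero {A B : SSet.{u}} (x : A _⦋0⦌) (b : B _⦋0⦌) :
    (SSet.const x : B ⟶ A).app (op ⦋0⦌) b = x := by
  simp [SSet.const_app]

/-- Move one coordinate at a time, keeping the other one constant. -/
theorem π₀_mk_pair {A B : SSet.{u}} {x x' : A _⦋0⦌} {y y' : B _⦋0⦌} (hx : π₀.mk x = π₀.mk x')
    (hy : π₀.mk y = π₀.mk y') :
    π₀.mk (X := A ⊗ B) (SCat.pair A B x y) = π₀.mk (X := A ⊗ B) (SCat.pair A B x' y') := by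
  have h₁ := π₀_mk_app (lift (𝟙 A) (SSet.const y)) hx
  have h₂ := π₀_mk_app (lift (SSet.const x') (𝟙 B)) hy
  have e : ∀ (x : A _⦋0⦌) (y : B _⦋0⦌), (lift (𝟙 A) (SSet.const y)).app _ x = SCat.pair A B x y :=
    fun x y => Prod.ext rfl (const_app_zero y _)
  have e' : ∀ (x : A _⦋0⦌) (y : B _⦋0⦌), (lift (SSet.const x) (𝟙 B)).app _ y = SCat.pair A B x y :=
    fun x y => Prod.ext (const_app_zero x _) rfl
  rw [e, e] at h₁
  rw [e', e'] at h₂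
  exact h₁.trans h₂

theorem π₀_mk_pi {n : ℕ} {A : Fin n → SSet.{u}} {x y : ∀ i, (A i) _⦋0⦌}
    (h : ∀ i, π₀.mk (x i) = π₀.mk (y i)) :
    π₀.mk (X := piSSet A) x = π₀.mk (X := piSSet A) y := by
  induction n with
  | zero => exact congrArg _ (funext fun i => i.elim0)
  | succ n ih =>
    have := π₀_mk_app (piCons A) (π₀_mk_pair (h 0)
      (ih (A := fun i => A i.succ) (x := fun i => x i.succ) (y := fun i => y i.succ)
        fun i => h i.succ))
    have e : ∀ x : ∀ i, (A i) _⦋0⦌, (piCons A).app _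
        (SCat.pair (A 0) (piSSet fun i => A i.succ) (x 0) fun i => x i.succ) = x :=
      fun x => Fin.cons_self_tail x
    rwa [e, e] at this

/-- The projections of a finite product of simplicial sets. -/
def piProj {n : ℕ} (A : Fin n → SSet.{u}) (i : Fin n) : piSSet A ⟶ A i where
  app _ := ↾fun x => x i
  naturality _ _ _ := rfl

/-- The inclusion of a summand has a retraction, which is constant at `x` on all other summands. -/
theorem π₀_mk_sigma {I : Type} {A : I → SSet.{u}} {i : I} {x y : (A i) _⦋0⦌}
    (h : π₀.mk ((sigmaIncl A i).app _ x) = π₀.mk ((sigmaIncl A i).app _ y)) :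
    π₀.mk x = π₀.mk y := by
  classical
  let r : sigmaSSet A ⟶ A i :=
    sigmaDesc fun j => if h : j = i then eqToHom (by rw [h]) else SSet.const x
  have hr : sigmaIncl A i ≫ r = 𝟙 _ := by
    have : sigmaIncl A i ≫ r = if h : i = i then eqToHom (by rw [h]) else SSet.const x := rfl
    rw [this, dif_pos rfl, eqToHom_refl]
  have h' := congrArg (mapπ₀ r) h
  rwa [← mapπ₀_mk, ← mapπ₀_mk, ← mapπ₀_comp_apply, ← mapπ₀_comp_apply, hr,
    mapπ₀_id_apply, mapπ₀_id_apply] at h'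

/-- Both ends of an edge of a constant simplicial set are the edge itself. -/
theorem π₀_mk_const {T : Type u} {x y : T}
    (h : π₀.mk (X := (Functor.const _).obj T) x = π₀.mk (X := (Functor.const _).obj T) y) :
    x = y := by
  let f : π₀ ((Functor.const _).obj T : SSet.{u}) → T := π₀.lift (fun z : T => z) (fun a b e =>
    (e.src_eq.symm.trans (rfl : (e.edge : T) = e.edge)).trans e.tgt_eq)
  exact congrArg f h

/-- Paths lift along Kan fibrations, starting at either end. -/
theorem exists_lift_π₀ {A B : SSet.{u}} (p : A ⟶ B) (hp : modelCategoryQuillen.J.rlp p)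
    (x : A _⦋0⦌) (y : B _⦋0⦌) (h : π₀.mk (p.app _ x) = π₀.mk y) :
    ∃ x' : A _⦋0⦌, p.app _ x' = y ∧ π₀.mk x' = π₀.mk x := by
  have : Fibration p := (modelCategoryQuillen.fibration_iff p).2 hp
  have hedge : ∀ {b c : B _⦋0⦌} (e : Edge b c) (i : Fin 2) (x : A _⦋0⦌),
      B.δ i e.edge = p.app _ x → ∃ s : A _⦋1⦌, p.app _ s = e.edge ∧ A.δ i s = x := by
    intro b c e i x hx
    -- The horn of `Δ[1]` with index `i.rev` is a single vertex, its face `i`, so there is no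
    -- compatibility to check.
    have hf : horn.IsCompatible (n := 0) (i := i.rev) (fun (j : Fin 2) _ => yonedaEquiv.symm x) :=
      trivial
    have comm : ∀ (j : Fin 2) (_ : j ≠ i.rev), yonedaEquiv.symm x ≫ p =
        stdSimplex.δ j ≫ yonedaEquiv.symm e.edge := by
      intro j hj
      obtain rfl : j = i := by fin_cases i <;> fin_cases j <;> simp_all
      rw [stdSimplex.δ_comp_yonedaEquiv_symm, hx, yonedaEquiv_symm_comp]
    obtain ⟨φ, hφ, hφ'⟩ := hf.exists_lift p _ comm
    refine ⟨yonedaEquiv φ, ?_, ?_⟩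
    · rw [← yonedaEquiv_comp, hφ', Equiv.apply_symm_apply]
    · have := congrArg yonedaEquiv (hφ i (by fin_cases i <;> decide))
      rwa [stdSimplex.yonedaEquiv_δ_comp, Equiv.apply_symm_apply] at this
  -- Components are classes of the equivalence relation generated by edges. Both directions are
  -- proved together so that the symmetric step of the induction only exchanges them.
  suffices ∀ b c : B _⦋0⦌, Relation.EqvGen π₀Rel b c →
      (∀ x, p.app _ x = b → ∃ x', p.app _ x' = c ∧ π₀.mk x' = π₀.mk x) ∧
      (∀ x, p.app _ x = c → ∃ x', p.app _ x' = b ∧ π₀.mk x' = π₀.mk x) from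
    (this _ _ ((π₀.mk_eq_mk_iff _ _).1 h)).1 x rfl
  intro b c hbc
  induction hbc with
  | rel b c hbc =>
    obtain ⟨e⟩ := hbc
    constructor
    · intro x hx
      obtain ⟨s, hs, rfl⟩ := hedge e 1 x (by rw [e.src_eq, hx])
      refine ⟨A.δ 0 s, ?_, (π₀.sound (Edge.mk' s)).symm⟩
      rw [← e.tgt_eq, ← hs, SSet.δ_naturality_apply]
    · intro x hx
      obtain ⟨s, hs, rfl⟩ := hedge e 0 x (by rw [e.tgt_eq, hx])
      refine ⟨A.δ 1 s, ?_, π₀.sound (Edge.mk' s)⟩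
      rw [← e.src_eq, ← hs, SSet.δ_naturality_apply]
  | refl b => exact ⟨fun x hx => ⟨x, hx, rfl⟩, fun x hx => ⟨x, hx, rfl⟩⟩
  | symm b c _ ih => exact ih.symm
  | trans b c d _ _ ih₁ ih₂ =>
    constructor
    · intro x hx
      obtain ⟨x', hx', h'⟩ := ih₁.1 x hx
      obtain ⟨x'', hx'', h''⟩ := ih₂.1 x' hx'
      exact ⟨x'', hx'', h''.trans h'⟩
    · intro x hx
      obtain ⟨x', hx', h'⟩ := ih₂.2 x hx
      obtain ⟨x'', hx'', h''⟩ := ih₁.2 x' hx'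
      exact ⟨x'', hx'', h''.trans h'⟩

end Components

end Algebroid

namespace Algebroid

section HomotopyEquivalences

open MonoidalCategory SCat HomotopicalAlgebra

/-! ### Homotopy equivalences -/

namespace SCat

variable {X Y : SCat.{u}}

/-- Two `0`-simplices of a simplicial set of morphisms are in the same component. -/
def SameComp (X : SCat.{u}) {a b : Level X (op (.mk 0))} (f g : a ⟶ b) : Prop :=
  SSet.π₀.mk (X := X.str.Hom a b) f = SSet.π₀.mk (X := X.str.Hom a b) g

theorem SameComp.comp {a b c : Level X (op (.mk 0))} {f f' : a ⟶ b} {g g' : b ⟶ c}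
    (hf : X.SameComp f f') (hg : X.SameComp g g') : X.SameComp (f ≫ g) (f' ≫ g') :=
  π₀_mk_app (eComp SSet (C := X.carrier) a b c) (π₀_mk_pair hf hg)

theorem SameComp.map (F : X ⟶ Y) {a b : Level X (op (.mk 0))} {f f' : a ⟶ b}
    (hf : X.SameComp f f') :
    Y.SameComp ((levelMap F (op (.mk 0))).map f) ((levelMap F (op (.mk 0))).map f') :=
  π₀_mk_app (EnrichedFunctor.map (C := X.carrier) (D := Y.carrier) F a b) hf

theorem isHomotopyEquiv_iff {a b : Level X (op (.mk 0))} (f : a ⟶ b) :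
    IsHomotopyEquiv X f ↔ ∃ g : b ⟶ a, X.SameComp (f ≫ g) (𝟙 a) ∧ X.SameComp (g ≫ f) (𝟙 b) :=
  Iff.rfl

/-- Homotopy equivalences can be lifted along a fibration with prescribed target. -/
theorem exists_lift_target (F : X ⟶ Y) (hF : fibrations SCat.{u} F) (a : Level X (op (.mk 0)))
    (b : Level Y (op (.mk 0))) (p : b ⟶ (levelMap F (op (.mk 0))).obj a)
    (hp : IsHomotopyEquiv Y p) :
    ∃ (a' : Level X (op (.mk 0))) (d : a' ⟶ a) (h : (levelMap F (op (.mk 0))).obj a' = b),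
      IsHomotopyEquiv X d ∧ (levelMap F (op (.mk 0))).map d = eqToHom h ≫ p := by
  obtain ⟨p', h₁, h₂⟩ := (isHomotopyEquiv_iff _).1 hp
  -- The definition of a fibration lifts only with prescribed source, so it is applied to a homotopy
  -- inverse `p'` of `p`. A homotopy inverse `d₂` of the lift has the right source and target, but
  -- lies over `p` only up to components.
  obtain ⟨a', d₁, h, hd₁, hd₁'⟩ := hF.2 a b p' ⟨p, h₂, h₁⟩
  subst h
  rw [eqToHom_refl, Category.comp_id] at hd₁'
  obtain ⟨d₂, h₃, h₄⟩ := (isHomotopyEquiv_iff _).1 hd₁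
  have hd₂ : Y.SameComp ((levelMap F (op (.mk 0))).map d₂) p := by
    have e₁ : Y.SameComp ((levelMap F _).map d₂ ≫ p' ≫ p) ((levelMap F _).map d₂) := by
      simpa using SameComp.comp (f := (levelMap F _).map d₂) rfl h₂
    have e₂ : Y.SameComp ((levelMap F _).map d₂ ≫ p' ≫ p) p := by
      have := SameComp.comp (h₄.map F) (g := p) rfl
      simpa [hd₁'] using this
    exact e₁.symm.trans e₂
  -- Path lifting in the mapping space replaces `d₂` by a morphism of the same component lying
  -- exactly over `p`.
  obtain ⟨d, hd, hd'⟩ := exists_lift_π₀ _ (hF.1 a' a) d₂ p hd₂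
  replace hd' : X.SameComp d d₂ := hd'
  refine ⟨a', d, rfl, ⟨d₁, ?_, ?_⟩, ?_⟩
  · exact (hd'.comp (g := d₁) rfl).trans h₄
  · exact (SameComp.comp (f := d₁) rfl hd').trans h₃
  · rw [eqToHom_refl, Category.id_comp]
    exact hd

end SCat

/-! ### Homotopy equivalences in categories of operators -/

section

variable (X : SCat.{u}) {n : SimplexCategory}

/-- The simplicial set of strings of length one. -/
def unitStr {m : ℕ} (u : Fin m → X.carrier × X.carrier) (i : Fin m) (v : X.carrier × X.carrier) :
    X.str.Hom v.1 (u i).1 ⊗ X.str.Hom (u i).2 v.2 ⟶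
      strSSet X u i.castSucc i.succ v.1 v.2 :=
  X.str.Hom v.1 (u i).1 ◁ strLast X u i.succ (u i).2 v.2 ≫ strCons X u i i.succ v.1 v.2

theorem unitStr_bijective {m : ℕ} (u : Fin m → X.carrier × X.carrier) (i : Fin m)
    (v : X.carrier × X.carrier) (k : SimplexCategoryᵒᵖ) :
    Function.Bijective ((unitStr X u i v).app k) := by
  refine (strCons_bijective X u i i.succ (Fin.castSucc_lt_succ).ne' v.1 v.2 k).comp
    (f := Prod.map id ((strLast X u i.succ (u i).2 v.2).app k)) ?_
  exact Function.bijective_id.prodMap (strLast_bijective X u i.succ (u i).2 v.2 k)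

/-- The simplicial set of pairs of sequences of morphisms between two sequences of pairs. -/
abbrev diagSSet (u v : Fin n.len → X.carrier × X.carrier) : SSet.{u} :=
  piSSet fun i => X.str.Hom (v i).1 (u i).1 ⊗ X.str.Hom (u i).2 (v i).2

/-- Pairs of sequences of morphisms, as morphisms over the identity in the first summand. -/
def diagStr (u v : Fin n.len → X.carrier × X.carrier) :
    diagSSet X u v ⟶ piSSet fun i => strSSet X u ((𝟙 n : n ⟶ n).toOrderHom i.castSucc)
      ((𝟙 n : n ⟶ n).toOrderHom i.succ) (v i).1 (v i).2 :=
  piMap fun i => unitStr X u i (v i)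

theorem diagStr_bijective (u v : Fin n.len → X.carrier × X.carrier) (k : SimplexCategoryᵒᵖ) :
    Function.Bijective ((diagStr X u v).app k) :=
  Function.Bijective.piMap fun i => unitStr_bijective X u i (v i) k

/-- Pairs of sequences of morphisms, as morphisms of the category of operators. -/
def diagMap (u v : Fin n.len → X.carrier × X.carrier) :
    diagSSet X u v ⟶ (sOObj X).str.Hom (OObj.mk n u) (OObj.mk n v) :=
  diagStr X u v ≫ sigmaIncl (fun φ : n ⟶ n => piSSet fun i : Fin n.len =>
    strSSet X u (φ.toOrderHom i.castSucc) (φ.toOrderHom i.succ) (v i).1 (v i).2) (𝟙 n) ≫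
       ofHomSigma X (OObj.mk n u) (OObj.mk n v)

variable {X}

/-- A sequence of pairs, as an object of the category of operators. -/
abbrev diagObj (u : Fin n.len → Level X (op (.mk 0)) × Level X (op (.mk 0))) :
    Level (sOObj X) (op (.mk 0)) := OObj.mk (C := X.carrier) n u

variable (X)

/-- The morphism of the category of operators given by two sequences of morphisms. -/
def diagHom {u v : Fin n.len → Level X (op (.mk 0)) × Level X (op (.mk 0))}
    (p : ∀ i, (v i).1 ⟶ (u i).1)
    (q : ∀ i, (u i).2 ⟶ (v i).2) :
    diagObj u ⟶ diagObj v :=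
  (diagMap X u v).app _ fun i => SCat.pair _ _ (p i) (q i)

variable {X}
variable {u v : Fin n.len → Level X (op (.mk 0)) × Level X (op (.mk 0))}

/-- Diagonal morphisms form, up to isomorphism, the summand of the mapping space over `𝟙 n`, which
is a product; components of a summand inject into those of the coproduct, and components of a finite
product are detected by the projections. -/
theorem diagHom_sameComp_iff
    {p p' : ∀ i, (v i).1 ⟶ (u i).1}
    {q q' : ∀ i, (u i).2 ⟶ (v i).2} :
    (sOObj X).SameComp (diagHom X p q) (diagHom X p' q') ↔
      ∀ i, X.SameComp (p i) (p' i) ∧ X.SameComp (q i) (q' i) := by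
  constructor
  · intro h i
    have h₁ := π₀_mk_of_app (ofHomSigma X (OObj.mk n u) (OObj.mk n v))
      (ofHomSigma_bijective X (OObj.mk n u) (OObj.mk n v)) h
    have h₂ := π₀_mk_of_app (diagStr X u v) (diagStr_bijective X u v) (π₀_mk_sigma h₁)
    have h₃ := π₀_mk_app (piProj _ i) h₂
    exact ⟨π₀_mk_app (CartesianMonoidalCategory.fst _ _) h₃,
      π₀_mk_app (CartesianMonoidalCategory.snd _ _) h₃⟩
  · intro h
    exact π₀_mk_app (diagMap X u v) (π₀_mk_pi fun i => π₀_mk_pair (h i).1 (h i).2)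

theorem isHomotopyEquiv_diagHom
    {p : ∀ i, (v i).1 ⟶ (u i).1}
    {q : ∀ i, (u i).2 ⟶ (v i).2}
    (hp : ∀ i, IsHomotopyEquiv X (p i)) (hq : ∀ i, IsHomotopyEquiv X (q i)) :
    IsHomotopyEquiv (sOObj X) (diagHom X p q) := by
  choose p' hp₁ hp₂ using hp
  choose q' hq₁ hq₂ using hq
  refine ⟨diagHom X p' q', ?_, ?_⟩
  · exact diagHom_sameComp_iff.2 fun i => ⟨hp₂ i, hq₁ i⟩
  · exact diagHom_sameComp_iff.2 fun i => ⟨hp₁ i, hq₂ i⟩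

theorem exists_eq_diagHom (e : diagObj u ⟶ diagObj v)
    (he : OHom.base (C := Level X (op (.mk 0))) e = 𝟙 n) : ∃ p q, e = diagHom X p q := by
  obtain ⟨φ, s⟩ := e
  obtain rfl : φ = 𝟙 n := he
  obtain ⟨x, hx⟩ := (diagStr_bijective X u v (op (.mk 0))).2 s
  refine ⟨fun i => (x i).1, fun i => (x i).2, ?_⟩
  exact congrArg (OHom.mk (C := Level X (op (.mk 0))) (U := OObj.mk n u) (V := OObj.mk n v) (𝟙 n))
    hx.symm

/-- The base is the image under the projection to `Ass`, whose mapping spaces are discrete. -/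
theorem base_eq_of_sameComp {U V : Level (sOObj X) (op (.mk 0))} {e e' : U ⟶ V}
    (h : (sOObj X).SameComp e e') : OHom.base (C := Level X (op (.mk 0))) e =
      OHom.base (C := Level X (op (.mk 0))) e' := by
  have := π₀_mk_const (π₀_mk_app (EnrichedFunctor.map (C := (sOObj X).carrier)
    (D := sAss.carrier) (sOProj X) U V) h)
  exact Quiver.Hom.op_inj (ULift.up_injective this)

/-- The bases of a homotopy equivalence and its inverse are mutually inverse by
`base_eq_of_sameComp`, and the only isomorphisms of the simplex category are identities. What is
left is a pair of families of morphisms, which can be inverted componentwise. -/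
theorem exists_of_isHomotopyEquiv {U V : Level (sOObj X) (op (.mk 0))} (e : U ⟶ V)
    (he : IsHomotopyEquiv (sOObj X) e) :
    ∃ (n : SimplexCategory) (u v : Fin n.len → Level X (op (.mk 0)) × Level X (op (.mk 0)))
      (hU : diagObj u = U) (hV : diagObj v = V) (p : _) (q : _),
      e = eqToHom hU.symm ≫ diagHom X (u := u) (v := v) p q ≫ eqToHom hV ∧
      (∀ i, IsHomotopyEquiv X (p i)) ∧ ∀ i, IsHomotopyEquiv X (q i) := by
  obtain ⟨g, h₁, h₂⟩ := (isHomotopyEquiv_iff _).1 he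
  obtain ⟨n, u⟩ := U
  obtain ⟨n', v⟩ := V
  have b₁ := base_eq_of_sameComp h₁
  have b₂ := base_eq_of_sameComp h₂
  let φ : n' ⟶ n := OHom.base (C := Level X (op (.mk 0))) e
  let ψ : n ⟶ n' := OHom.base (C := Level X (op (.mk 0))) g
  replace b₁ : ψ ≫ φ = 𝟙 n := b₁
  replace b₂ : φ ≫ ψ = 𝟙 n' := b₂
  obtain rfl : n' = n := SimplexCategory.skeletal ⟨⟨φ, ψ, b₂, b₁⟩⟩
  have : IsIso φ := ⟨ψ, b₂, b₁⟩
  have : IsIso ψ := ⟨φ, b₁, b₂⟩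
  obtain ⟨p, q, rfl⟩ := exists_eq_diagHom e (SimplexCategory.eq_id_of_isIso φ)
  obtain ⟨p', q', rfl⟩ := exists_eq_diagHom g (SimplexCategory.eq_id_of_isIso ψ)
  -- The composite of diagonal morphisms is by definition the diagonal morphism of the composites,
  -- in reversed order for the contravariant family `p`.
  replace h₁ := (diagHom_sameComp_iff (u := u) (v := u) (p := fun i => p' i ≫ p i)
    (q := fun i => q i ≫ q' i) (p' := fun _ => 𝟙 _) (q' := fun _ => 𝟙 _)).1 h₁
  replace h₂ := (diagHom_sameComp_iff (u := v) (v := v) (p := fun i => p i ≫ p' i)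
    (q := fun i => q' i ≫ q i) (p' := fun _ => 𝟙 _) (q' := fun _ => 𝟙 _)).1 h₂
  refine ⟨n', u, v, rfl, rfl, p, q, ?_, fun i => ⟨p' i, (h₂ i).1, (h₁ i).1⟩,
    fun i => ⟨q' i, (h₁ i).2, (h₂ i).2⟩⟩
  exact ((Category.id_comp _).trans (Category.comp_id _)).symm

theorem SCat.IsHomotopyEquiv.symm {a b : Level X (op (.mk 0))} {e : a ⟶ b}
    (he : IsHomotopyEquiv X e) : ∃ g : b ⟶ a, IsHomotopyEquiv X g := by
  obtain ⟨g, h₁, h₂⟩ := he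
  exact ⟨g, e, h₂, h₁⟩

end

/-! ### The functor to categories of operators preserves fibrations and weak equivalences -/

theorem sO_fibrations : fibrations SCat.{u} ≤ (fibrations (Over sAss.{u})).inverseImage sO := by
  intro X Y F hF
  refine ⟨fun U V => sOMap_map_mem SSet.modelCategoryQuillen.J.rlp F hF.1 U V, ?_⟩
  intro U V e he
  obtain ⟨n, u', v, hU, rfl, p, q, rfl, hp, hq⟩ := exists_of_isHomotopyEquiv e he
  obtain ⟨m, u⟩ := U
  obtain rfl : n = m := congrArg OObj.len hU
  obtain rfl : u' = seqMap F u := eq_of_heq (OObj.mk.inj hU).2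
  -- The morphisms `p i` end in the image of the given object and the `q i` start there, so the
  -- former are lifted with prescribed target and the latter by the definition of a fibration.
  choose a d ha hd hd' using fun i => SCat.exists_lift_target F hF (u i).1 _ (p i) (hp i)
  choose b d₂ hb hd₂ hd₂' using fun i => hF.2 (u i).2 _ (q i) (hq i)
  obtain rfl : v = fun i => ((levelMap F (op (.mk 0))).obj (a i),
    (levelMap F (op (.mk 0))).obj (b i)) := funext fun i => Prod.ext (ha i).symm (hb i).symm
  refine ⟨diagObj fun i => (a i, b i), diagHom X (u := u) d d₂, rfl,
    isHomotopyEquiv_diagHom hd hd₂, ?_⟩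
  obtain rfl : p = fun i => (levelMap F (op (.mk 0))).map (d i) :=
    funext fun i => ((hd' i).trans (Category.id_comp _)).symm
  obtain rfl : q = fun i => (levelMap F (op (.mk 0))).map (d₂ i) :=
    funext fun i => (hd₂' i).symm.trans (Category.comp_id _)
  exact (Category.comp_id _).trans ((Category.id_comp _).trans (Category.comp_id _)).symm

theorem sO_weakEquivalences : weakEquivalences SCat.{u} ≤
    (weakEquivalences (Over sAss.{u})).inverseImage sO := by
  intro X Y F hF
  refine ⟨fun U V => sOMap_map_mem weakEq F hF.1 U V, ?_⟩
  rintro ⟨n, v⟩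
  choose a e he using fun i => hF.2 (v i).1
  -- The first members of the pairs are contravariant, so the equivalences found for them are
  -- inverted.
  choose e' he' using fun i => SCat.IsHomotopyEquiv.symm (he i)
  choose b f hf using fun i => hF.2 (v i).2
  exact ⟨OObj.mk n fun i => (a i, b i), diagHom Y e' f, isHomotopyEquiv_diagHom he' hf⟩

end HomotopyEquivalences

end Algebroid

/-! ### The adjunction between ordinary categories. -/

namespace Algebroid

/-! ### Formal adjunctions along dense functors -/

section

open Functor

variable {C C' D : Type*} [Category* C] [Category* C'] [Category* D] {ι : C ⥤ C'} {L : C ⥤ D}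
  {R : D ⥤ C'} (adj : FormalAdjunction ι L R)

theorem FormalAdjunction.naturality_left_symm {c c' : C} (f : c ⟶ c') {d : D}
    (g : ι.obj c' ⟶ R.obj d) :
    (adj.homEquiv c d).symm (ι.map f ≫ g) = L.map f ≫ (adj.homEquiv c' d).symm g := by
  rw [Equiv.symm_apply_eq, adj.naturality_left, Equiv.apply_symm_apply]

variable {Lhat : C' ⥤ D} {η : L ⟶ ι ⋙ Lhat}
  (hL : (LeftExtension.mk Lhat η).IsPointwiseLeftKanExtension)

theorem hom_ext_of_denseAt {T T' : C'} (hT : ι.DenseAt T) {k k' : T ⟶ T'}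
    (h : ∀ (c : C) (x : ι.obj c ⟶ T), x ≫ k = x ≫ k') : k = k' := by
  refine hT.hom_ext fun j => ?_
  have : ((LeftExtension.mk (𝟭 C') ι.rightUnitor.inv).coconeAt T).ι.app j = j.hom :=
    Category.id_comp _
  rw [this]
  exact h _ _

theorem exists_hom_of_denseAt {T T' : C'} (hT : ι.DenseAt T)
    (s : ∀ (c : C) (_ : ι.obj c ⟶ T), ι.obj c ⟶ T')
    (hs : ∀ {c c' : C} (f : c ⟶ c') (x : ι.obj c' ⟶ T), ι.map f ≫ s c' x = s c (ι.map f ≫ x)) :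
    ∃ k : T ⟶ T', ∀ (c : C) (x : ι.obj c ⟶ T), x ≫ k = s c x := by
  let t : Limits.Cocone (CostructuredArrow.proj ι T ⋙ ι) :=
    { pt := T'
      ι := { app j := s j.left j.hom
             naturality i j f := by
              have := hs f.left j.hom
              rw [CostructuredArrow.w f] at this
              exact this.trans (Category.comp_id _).symm } }
  refine ⟨hT.desc t, fun c x => ?_⟩
  have := hT.fac t (CostructuredArrow.mk x)
  refine Eq.trans ?_ this
  exact congrArg (· ≫ hT.desc t) (Category.id_comp x).symm

theorem hom_ext_of_isPointwise (hL : (LeftExtension.mk Lhat η).IsPointwiseLeftKanExtension)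
    {T : C'} {X : D} {k k' : Lhat.obj T ⟶ X}
    (h : ∀ (c : C) (x : ι.obj c ⟶ T), η.app c ≫ Lhat.map x ≫ k = η.app c ≫ Lhat.map x ≫ k') :
    k = k' :=
  (hL T).hom_ext' h

theorem exists_hom_of_isPointwise (hL : (LeftExtension.mk Lhat η).IsPointwiseLeftKanExtension)
    {T : C'} {X : D} (s : ∀ (c : C) (_ : ι.obj c ⟶ T), L.obj c ⟶ X)
    (hs : ∀ {c c' : C} (f : c ⟶ c') (x : ι.obj c' ⟶ T), L.map f ≫ s c' x = s c (ι.map f ≫ x)) :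
    ∃ k : Lhat.obj T ⟶ X, ∀ (c : C) (x : ι.obj c ⟶ T), η.app c ≫ Lhat.map x ≫ k = s c x := by
  let t : Limits.Cocone (CostructuredArrow.proj ι T ⋙ L) :=
    { pt := X
      ι := { app j := s j.left j.hom
             naturality i j f := by
              have := hs f.left j.hom
              rw [CostructuredArrow.w f] at this
              exact this.trans (Category.comp_id _).symm } }
  refine ⟨(hL T).desc t, fun c x => ?_⟩
  have := (hL T).fac t (CostructuredArrow.mk x)
  exact (Category.assoc _ _ _).symm.trans this

-- Maps `Lhat T ⟶ X` are compatible families of maps `L c ⟶ X` indexed by `x : ι c ⟶ T`, by the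
-- colimit formula. Through `adj` these are compatible families `ι c ⟶ R X`, which by density are
-- the maps `T ⟶ R X`.
include adj hL in
theorem FormalAdjunction.exists_adjunction (hd : ∀ T, ι.DenseAt T) : ∃ a : Lhat ⊣ R,
    ∀ (T : C') (X : D) (k : Lhat.obj T ⟶ X) (c : C) (x : ι.obj c ⟶ T),
      x ≫ a.homEquiv T X k = adj.homEquiv c X (η.app c ≫ Lhat.map x ≫ k) := by
  have hη : ∀ {c c' : C} (f : c ⟶ c'), L.map f ≫ η.app c' = η.app c ≫ Lhat.map (ι.map f) :=
    fun f => η.naturality f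
  have h₁ : ∀ (T : C') (X : D) (k : Lhat.obj T ⟶ X), ∃ k' : T ⟶ R.obj X,
      ∀ (c : C) (x : ι.obj c ⟶ T), x ≫ k' = adj.homEquiv c X (η.app c ≫ Lhat.map x ≫ k) :=
    fun T X k => exists_hom_of_denseAt (hd T) _ fun f x => by
      rw [← adj.naturality_left, ← Category.assoc, hη, Functor.map_comp]
      simp
  have h₂ : ∀ (T : C') (X : D) (k : T ⟶ R.obj X), ∃ k' : Lhat.obj T ⟶ X,
      ∀ (c : C) (x : ι.obj c ⟶ T),
        η.app c ≫ Lhat.map x ≫ k' = (adj.homEquiv c X).symm (x ≫ k) :=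
    fun T X k => exists_hom_of_isPointwise hL _ fun f x => by
      rw [← adj.naturality_left_symm, Category.assoc]
  choose p hp using h₁
  choose q hq using h₂
  refine ⟨Adjunction.mkOfHomEquiv
    { homEquiv T X :=
        { toFun := p T X
          invFun := q T X
          left_inv k := hom_ext_of_isPointwise hL fun c x => by
            rw [hq, hp, Equiv.symm_apply_apply]
          right_inv k := hom_ext_of_denseAt (hd T) fun c x => by
            rw [hp, hq, Equiv.apply_symm_apply] }
      homEquiv_naturality_left_symm {T' T X} f g := hom_ext_of_isPointwise hL fun c x => by
        dsimp
        rw [hq, ← Category.assoc x f g, ← hq, Functor.map_comp, Category.assoc]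
      homEquiv_naturality_right {T X X'} f g := hom_ext_of_denseAt (hd T) fun c x => by
        dsimp
        rw [hp, ← Category.assoc x, hp, ← adj.naturality_right]
        simp }, fun T X k c x => ?_⟩
  rw [Adjunction.mkOfHomEquiv_homEquiv]
  exact hp T X k c x

end

/-! ### Density of the simplices -/

/-- Simplices of a category are sequences of composable morphisms. -/
def ofComposable {C : Cat.{u, u}} {n : SimplexCategory} (c : ComposableArrows C n.len) :
    simplex.{u}.obj n ⟶ C :=
  Functor.toCatHom (C := AsSmall.{u} (Fin (n.len + 1))) (AsSmall.down ⋙ c)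

/-- The sequence of composable morphisms of a simplex of a category. -/
def toComposable {C : Cat.{u, u}} {n : SimplexCategory} (c : simplex.{u}.obj n ⟶ C) :
    ComposableArrows C n.len :=
  (AsSmall.up : Fin (n.len + 1) ⥤ AsSmall.{u} (Fin (n.len + 1))) ⋙ c.toFunctor

/-- The simplices of the nerve of `T.left` are objects of the comma category, so a cocone amounts to
a map of nerves over the nerve of `Ass`. The nerve functor being fully faithful, this is the same as
a functor over `Ass`. -/
theorem denseAt_simplexInclusion (T : Over Ass.{u}) :
    Nonempty (simplexInclusion.{u}.DenseAt T) := by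
  refine ⟨?_⟩
  let σ (n : SimplexCategory) (c : ComposableArrows T.left n.len) :
      CostructuredArrow simplexInclusion.{u} T :=
    CostructuredArrow.mk (Y := (CostructuredArrow.mk (ofComposable c ≫ T.hom) : SimplexAss.{u}))
      (Over.homMk (ofComposable c))
  let φ (s : Limits.Cocone (CostructuredArrow.proj simplexInclusion.{u} T ⋙ simplexInclusion)) :
      nerveFunctor.obj T.left ⟶ nerveFunctor.obj s.pt.left :=
    { app n := ↾fun c => toComposable (s.ι.app (σ n.unop c)).left
      naturality m n θ := by
        ext c
        let g : σ n.unop ((nerveFunctor.obj T.left).map θ c) ⟶ σ m.unop c :=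
          CostructuredArrow.homMk (CostructuredArrow.homMk θ.unop rfl) rfl
        have := congrArg (fun h => toComposable h.left) (s.w g)
        exact this.symm }
  have hφ (s : Limits.Cocone (CostructuredArrow.proj simplexInclusion.{u} T ⋙ simplexInclusion)) :
      nerveFunctor.preimage (φ s) ≫ s.pt.hom = T.hom := by
    apply nerveFunctor.map_injective
    rw [Functor.map_comp, Functor.map_preimage]
    ext n c
    exact congrArg toComposable (Over.w (s.ι.app (σ n.unop c)))
  have key (s : Limits.Cocone (CostructuredArrow.proj simplexInclusion.{u} T ⋙ simplexInclusion))
      (m : T.left ⟶ s.pt.left) : nerveFunctor.map m = φ s ↔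
        ∀ j : CostructuredArrow simplexInclusion.{u} T, j.hom.left ≫ m = (s.ι.app j).left := by
    constructor
    · intro h j
      have := ConcreteCategory.congr_hom (NatTrans.congr_app h (op j.left.left))
        (toComposable j.hom.left)
      -- Every object `j` of the comma category receives a map over the identity of its simplex from
      -- the object attached to that simplex, so the legs at the objects `σ n c` determine all legs.
      let g : σ j.left.left (toComposable j.hom.left) ⟶ j :=
        CostructuredArrow.homMk (CostructuredArrow.homMk (𝟙 _)
          ((congrArg (· ≫ j.left.hom) (simplex.{u}.map_id j.left.left)).trans
            ((Category.id_comp _).trans (Over.w j.hom).symm))) (by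
            ext1
            exact (congrArg (· ≫ j.hom.left) (simplex.{u}.map_id j.left.left)).trans
              (Category.id_comp _))
      have hg := congrArg (fun h => h.left) (s.w g)
      have hg' : (s.ι.app (σ j.left.left (toComposable j.hom.left))).left = (s.ι.app j).left :=
        hg.symm.trans ((congrArg (· ≫ (s.ι.app j).left) (simplex.{u}.map_id j.left.left)).trans
              (Category.id_comp _))
      exact (congrArg (ofComposable (n := j.left.left)) this).trans hg'
    · intro h
      ext n c
      exact congrArg toComposable (h (σ n.unop c))
  exact
    { desc s := Over.homMk (nerveFunctor.preimage (φ s)) (hφ s)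
      fac s j := by
        ext1
        refine (congrArg (· ≫ nerveFunctor.preimage (φ s)) (Category.id_comp _)).trans ?_
        exact (key s _).1 (Functor.map_preimage _ _) j
      uniq s m hm := by
        ext1
        apply nerveFunctor.map_injective
        refine Eq.trans ((key s m.left).2 fun j => ?_) (Functor.map_preimage _ _).symm
        rw [← hm j]
        exact (congrArg (· ≫ m.left) (Category.id_comp _)).symm }

/-- Full faithfulness of `simplex` passes to `simplexInclusion`, and makes the unit of the pointwise
Kan extension invertible. -/
instance : simplex.{u}.Faithful where
  map_injective {m n} f g h := by
    ext i : 3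
    have := congrArg (fun k => (toComposable k).obj i) h
    exact congrArg ULift.down this

instance : simplex.{u}.Full where
  map_surjective {m n} f := by
    refine ⟨SimplexCategory.Hom.mk ⟨fun i => AsSmall.down.obj ((toComposable f).obj i),
      fun i j h => leOfHom (AsSmall.down.map ((toComposable f).map (homOfLE h)))⟩, ?_⟩
    refine Cat.ext ?_
    refine Functor.hext (fun _ => rfl) fun i j g => heq_of_eq ?_
    exact ULift.ext _ _ (Subsingleton.elim (α := @Quiver.Hom (Fin (n.len + 1)) _ _ _) _ _)

/-- The colimits required are indexed by essentially small categories, and `Cat` is cocomplete. -/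
instance (F : SimplexAss.{u} ⥤ Cat.{u, u}) :
    simplexInclusion.{u}.HasPointwiseLeftKanExtension F := by
  intro T
  have : LocallySmall.{u} (CostructuredArrow simplexInclusion.{u} T) := ⟨fun _ _ => inferInstance⟩
  exact Limits.hasColimitsOfShape_of_essentiallySmall.{u} _ _ |>.has_colimit _

end Algebroid

/-! ### Left adjoints of `O` preserve bijectivity on objects. -/

namespace Algebroid

/-! ### Operators of codiscrete categories -/

/-- The codiscrete category on a type: there is exactly one morphism between two objects. -/
structure Codisc (A : Type u) : Type u where
  /-- The element of the type. -/
  of : A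

instance (A : Type u) : Category.{u} (Codisc A) where
  Hom _ _ := PUnit.{u + 1}
  id _ := PUnit.unit
  comp _ _ := PUnit.unit

instance {A : Type u} (a b : Codisc A) : Unique (a ⟶ b) :=
  inferInstanceAs (Unique PUnit.{u + 1})

/-- The functor to a codiscrete category with given action on objects. -/
def toCodisc {C : Type u} [Category.{u} C] {A : Type u} (g : C → A) : C ⥤ Codisc A where
  obj c := ⟨g c⟩
  map _ := PUnit.unit

namespace Str

variable {C : Type u} [Category.{u} C] {m : ℕ} {u : Fin m → C × C}

theorem eq_of_subsingleton [∀ a b : C, Subsingleton (a ⟶ b)] {a b : Fin (m + 1)} {c d : C}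
    (s t : Str u a b c d) : s = t := by
  induction s with
  | last f =>
    obtain ⟨g, rfl⟩ := (last_bijective _ _ _).2 t
    exact congrArg last (Subsingleton.elim f g)
  | cons i f s ih =>
    have h := (cons_bijective (u := u) i _
      (ne_of_gt (Fin.castSucc_lt_succ.trans_le s.le)) _ _).2 t
    obtain ⟨⟨g, t⟩, rfl⟩ := h
    exact congrArg₂ (cons i) (Subsingleton.elim f g) (ih t)

theorem nonempty_of_le [∀ a b : C, Nonempty (a ⟶ b)] {a b : Fin (m + 1)} (h : a ≤ b) (c d : C) :
    Nonempty (Str u a b c d) := by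
  induction a using Fin.reverseInduction generalizing c with
  | last =>
    obtain rfl := le_antisymm h (Fin.le_last b)
    exact (inferInstance : Nonempty (c ⟶ d)).map last
  | cast i ih =>
    rcases h.lt_or_eq with h | rfl
    · obtain ⟨t⟩ := ih (Fin.castSucc_lt_iff_succ_le.1 h) (u i).2
      exact (inferInstance : Nonempty (c ⟶ (u i).1)).map fun f => cons i f t
    · exact (inferInstance : Nonempty (c ⟶ d)).map last

end Str

theorem OHom.eq_of_base {C : Type u} [Category.{u} C] {U V : OObj C} {f g : OHom U V}
    (h : f.base = g.base)
    (hs : ∀ (a b : Fin (U.len.len + 1)) (c d : C), Subsingleton (Str U.seq a b c d)) : f = g := by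
  obtain ⟨φ, s⟩ := f
  obtain ⟨ψ, t⟩ := g
  obtain rfl : φ = ψ := h
  exact congrArg (OHom.mk φ) (funext fun i => (hs _ _ _ _).elim _ _)

/-- Strings with given ends in a codiscrete category are unique, so a morphism of operators retains
only its base. -/
instance (A : Type u) : (OProj (Codisc A)).Faithful where
  map_injective h := OHom.eq_of_base (Quiver.Hom.op_inj (congrArg ULift.down h))
    fun _ _ _ _ => ⟨Str.eq_of_subsingleton⟩

theorem functor_ext_of_faithful {C D E : Type*} [Category* C] [Category* D] [Category* E]
    {F G : C ⥤ D} (P : D ⥤ E) [P.Faithful] (h : ∀ X, F.obj X = G.obj X) (hP : F ⋙ P = G ⋙ P) :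
    F = G := by
  refine CategoryTheory.Functor.ext h fun X Y f => P.map_injective ?_
  rw [Functor.map_comp, Functor.map_comp, eqToHom_map, eqToHom_map]
  exact Functor.congr_hom hP f

theorem OObj.mk_cast {A : Type u} {U : OObj A} {n : SimplexCategory} (h : n = U.len) :
    OObj.mk n (fun i => U.seq (Fin.cast (congrArg SimplexCategory.len h) i)) = U := by
  subst h
  rfl

theorem hom_ext_codisc {T : Over Ass.{u}} {A : Type u} {k k' : T ⟶ O.obj (Cat.of (Codisc A))}
    (h : ∀ t, k.left.toFunctor.obj t = k'.left.toFunctor.obj t) : k = k' := by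
  ext1
  refine Cat.ext (functor_ext_of_faithful (D := OObj (Codisc A)) (OProj (Codisc A)) h ?_)
  exact congrArg Cat.Hom.toFunctor ((Over.w k).trans (Over.w k').symm)

theorem base_le {n m : SimplexCategory} (φ : n ⟶ m) (i : Fin n.len) :
    φ.toOrderHom i.castSucc ≤ φ.toOrderHom i.succ :=
  φ.toOrderHom.monotone Fin.castSucc_lt_succ.le

/-- A functor over `Ass` to the category of operators of a codiscrete category is given by its
action on objects. -/
theorem exists_hom_codisc (T : Over Ass.{u}) {A : Type u} (V : T.left → OObj (Codisc A))
    (hV : ∀ t, T.hom.toFunctor.obj t = ULift.up (op (V t).len)) :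
    ∃ k : T ⟶ O.obj (Cat.of (Codisc A)), ∀ t, k.left.toFunctor.obj t = V t := by
  let e (t : T.left) : unop (ULift.down (T.hom.toFunctor.obj t)) = (V t).len :=
    congrArg (fun a => unop (ULift.down a)) (hV t)
  -- The lengths are taken from `T.hom` and the sequences of `V` transported to them, which makes
  -- `K` lie over `Ass` strictly.
  let K : T.left ⥤ OObj (Codisc A) :=
    { obj t := ⟨unop (ULift.down (T.hom.toFunctor.obj t)),
        fun i => (V t).seq (Fin.cast (congrArg SimplexCategory.len (e t)) i)⟩
      map f := ⟨(ULift.down (T.hom.toFunctor.map f)).unop, fun i =>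
        (Str.nonempty_of_le (base_le _ i) _ _).some⟩
      map_id t := (OProj (Codisc A)).map_injective (T.hom.toFunctor.map_id t)
      map_comp f g := (OProj (Codisc A)).map_injective (T.hom.toFunctor.map_comp f g) }
  exact ⟨Over.homMk (V := O.obj (Cat.of (Codisc A))) K.toCatHom (Cat.ext rfl), fun t => OObj.mk_cast (e t)⟩

/-- Functors from `Fhat T` to a codiscrete category are functions on objects, and correspond to maps
from `T` to its category of operators, which depend only on the objects of `T` and their images in
`Ass`. Hence the objects of `Fhat T` depend on nothing else. -/
theorem obj_bijective_of_adjunction {Fhat : Over Ass.{u} ⥤ Cat.{u, u}} (a : Fhat ⊣ O)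
    {T T' : Over Ass.{u}} (f : T ⟶ T') (hf : Function.Bijective f.left.toFunctor.obj) :
    Function.Bijective (Fhat.map f).toFunctor.obj := by
  constructor
  -- The identity on the objects of `Fhat T`, as a functor to a codiscrete category, extends along
  -- `Fhat.map f`: its adjunct is carried along the inverse of `f` on objects.
  · let A : Type u := Fhat.obj T
    let k : T ⟶ O.obj (Cat.of (Codisc A)) := a.homEquiv _ _ (toCodisc _root_.id).toCatHom
    let g := (Equiv.ofBijective _ hf).symm
    have hg (t) : f.left.toFunctor.obj (g t) = t := (Equiv.ofBijective _ hf).apply_symm_apply t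
    have hg' (t) : g (f.left.toFunctor.obj t) = t := (Equiv.ofBijective _ hf).symm_apply_apply t
    obtain ⟨k', hk'⟩ := exists_hom_codisc T' (fun t => k.left.toFunctor.obj (g t)) fun t => by
      refine Eq.trans ?_ (congrArg (fun h => (Cat.Hom.toFunctor h).obj (g t)) (Over.w k)).symm
      refine Eq.trans ?_ (congrArg (fun h => (Cat.Hom.toFunctor h).obj (g t)) (Over.w f))
      exact congrArg T'.hom.toFunctor.obj (hg t).symm
    have h : f ≫ k' = k := hom_ext_codisc fun t =>
      (hk' _).trans (congrArg k.left.toFunctor.obj (hg' t))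
    have h' : Fhat.map f ≫ (a.homEquiv _ _).symm k' = (toCodisc _root_.id).toCatHom := by
      rw [← a.homEquiv_naturality_left_symm, h]
      exact (a.homEquiv _ _).symm_apply_apply _
    intro x y hxy
    have hx := congrArg (fun h : Fhat.obj T ⟶ Cat.of (Codisc A) => (h.toFunctor.obj x).of) h'
    have hy := congrArg (fun h : Fhat.obj T ⟶ Cat.of (Codisc A) => (h.toFunctor.obj y).of) h'
    refine hx.symm.trans (Eq.trans ?_ hy)
    exact congrArg (fun z => (((a.homEquiv _ _).symm k').toFunctor.obj z).of) hxy
  -- The characteristic function of the image and the constant function `True` agree after `Fhat.map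
  -- f`. Their adjuncts then agree on the objects in the image of `f`, which are all objects.
  · let p (z : Fhat.obj T') : ULift.{u} Prop := ⟨z ∈ Set.range (Fhat.map f).toFunctor.obj⟩
    let q (z : Fhat.obj T') : ULift.{u} Prop := ⟨True⟩
    have h : Fhat.map f ≫ (toCodisc p).toCatHom = Fhat.map f ≫ (toCodisc q).toCatHom := by
      refine Cat.ext (CategoryTheory.Functor.ext (fun x => congrArg Codisc.mk (congrArg ULift.up ?_))
        fun _ _ _ => Subsingleton.elim (α := PUnit) _ _)
      exact eq_true ⟨x, rfl⟩
    have h' : (toCodisc p).toCatHom = (toCodisc q).toCatHom := by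
      apply (a.homEquiv _ _).injective
      refine hom_ext_codisc fun t => ?_
      obtain ⟨t, rfl⟩ := hf.2 t
      have := (a.homEquiv_naturality_left f _).symm.trans
        ((congrArg (a.homEquiv T (Cat.of (Codisc (ULift Prop)))) h).trans
          (a.homEquiv_naturality_left f _))
      exact congrArg (fun h => (Cat.Hom.toFunctor (CommaMorphism.left h)).obj t) this
    intro z
    exact of_eq_true (congrArg (fun h : Fhat.obj T' ⟶ Cat.of (Codisc (ULift Prop)) => (h.toFunctor.obj z).of.down) h')

end Algebroid

/-! ### Dimensionwise description of simplicial categories and construction of the extension. -/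

namespace Algebroid

/-! ### Simplicial categories as simplicial objects in categories -/

theorem isIso_toCatHom_of_bijective {C D : Type u} [Category.{u} C] [Category.{u} D] (F : C ⥤ D)
    [F.Full] [F.Faithful] (hF : Function.Bijective F.obj) : IsIso F.toCatHom := by
  let g := (Equiv.ofBijective _ hF).symm
  have hg (y) : F.obj (g y) = y := (Equiv.ofBijective _ hF).apply_symm_apply y
  have hg' (x) : g (F.obj x) = x := (Equiv.ofBijective _ hF).symm_apply_apply x
  let G : D ⥤ C :=
    { obj := g
      map {x y} f := F.preimage (eqToHom (hg x) ≫ f ≫ eqToHom (hg y).symm)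
      map_id x := F.map_injective (by simp)
      map_comp f f' := F.map_injective (by simp) }
  have h : F ⋙ G = 𝟭 C := by
    refine CategoryTheory.Functor.ext hg' fun x y f => F.map_injective ?_
    simp [G, eqToHom_map]
  have h' : G ⋙ F = 𝟭 D := by
    refine CategoryTheory.Functor.ext hg fun x y f => ?_
    simp [G]
  exact ⟨G.toCatHom, Cat.ext h, Cat.ext h'⟩

/-- Replace the action on objects of a functor by an equal function. -/
def replaceObj {C D : Type*} [Category* C] [Category* D] (F : C ⥤ D) (fo : C → D)
    (h : ∀ c, F.obj c = fo c) : C ⥤ D where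
  obj := fo
  map {a b} f := eqToHom (h a).symm ≫ F.map f ≫ eqToHom (h b)

theorem replaceObj_eq {C D : Type*} [Category* C] [Category* D] (F : C ⥤ D) (fo : C → D)
    (h : ∀ c, F.obj c = fo c) : replaceObj F fo h = F :=
  CategoryTheory.Functor.ext (fun c => (h c).symm) fun _ _ _ => rfl

/-- The morphism from the initial object of `SimplexCategoryᵒᵖ`. -/
def fromZero (k : SimplexCategoryᵒᵖ) : op (SimplexCategory.mk 0) ⟶ k :=
  (SimplexCategory.isTerminalZero.from k.unop).op

theorem fromZero_comp {k l : SimplexCategoryᵒᵖ} (θ : k ⟶ l) : fromZero k ≫ θ = fromZero l :=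
  Quiver.Hom.unop_inj (SimplexCategory.isTerminalZero.hom_ext _ _)

namespace SCat

instance : levels.{u}.Faithful where
  map_injective {X Y F G} h := by
    obtain ⟨fo, fm, fi, fc⟩ := F
    obtain ⟨go, gm, gi, gc⟩ := G
    have hk (k : SimplexCategoryᵒᵖ) := congrArg Cat.Hom.toFunctor (NatTrans.congr_app h k)
    obtain rfl : fo = go := congrArg (fun K => K.obj) (hk (op (.mk 0)))
    refine enrichedFunctor_ext rfl (heq_of_eq (funext₂ fun a b => ?_))
    ext k f
    have := Functor.congr_hom (hk k) (X := (a : Level X k)) (Y := (b : Level X k)) f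
    exact this.trans ((Category.id_comp _).trans (Category.comp_id _))

/-- All dimensions of a simplicial category have the same objects, so naturality along `fromZero k`
forces the object function of `t.app k` to equal that in dimension `0`. `replaceObj` makes this
equality strict, as a single object function is needed. -/
instance : levels.{u}.Full where
  map_surjective {X Y} t := by
    let fo : X.carrier → Y.carrier := (t.app (op (.mk 0))).toFunctor.obj
    have hT {k l : SimplexCategoryᵒᵖ} (θ : k ⟶ l) :
        levelOp X θ ⋙ (t.app l).toFunctor = (t.app k).toFunctor ⋙ levelOp Y θ :=
      congrArg Cat.Hom.toFunctor (t.naturality θ)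
    let T (k : SimplexCategoryᵒᵖ) : Level X k ⥤ Level Y k :=
      replaceObj (D := Level Y k) (t.app k).toFunctor fo
        fun a => Functor.congr_obj (hT (fromZero k)) a
    have hTt (k : SimplexCategoryᵒᵖ) : T k = (t.app k).toFunctor := replaceObj_eq _ _ _
    have hT' {k l : SimplexCategoryᵒᵖ} (θ : k ⟶ l) : levelOp X θ ⋙ T l = T k ⋙ levelOp Y θ := by
      rw [hTt, hTt]
      exact hT θ
    refine ⟨{ obj := fo, map a b :=
      { app k := ↾fun f => (T k).map f
        naturality k l θ := ConcreteCategory.hom_ext _ _ fun f => ?_ }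
              map_id a := ?_
              map_comp a b c := ?_ }, NatTrans.ext (funext fun k => Cat.ext (hTt k))⟩
    · exact (Functor.congr_hom (hT' θ) f).trans ((Category.id_comp _).trans (Category.comp_id _))
    · ext k x
      exact (T k).map_id a
    · ext k ⟨f, g⟩
      exact (T k).map_comp f g

section

variable (Z : SimplicialObject Cat.{u, u})

/-- The action on objects of the map from dimension `0` to dimension `k`. -/
def degenObj (k : SimplexCategoryᵒᵖ) (c : Z.obj (op (.mk 0))) : Z.obj k :=
  (Z.map (fromZero k)).toFunctor.obj c

theorem map_degenObj {k l : SimplexCategoryᵒᵖ} (θ : k ⟶ l) (c : Z.obj (op (.mk 0))) :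
    (Z.map θ).toFunctor.obj (degenObj Z k c) = degenObj Z l c := by
  have h : Z.map (fromZero k) ≫ Z.map θ = Z.map (fromZero l) := by
    rw [← Functor.map_comp, fromZero_comp]
  exact Functor.congr_obj (congrArg Cat.Hom.toFunctor h) c

/-- The action of simplicial operators on morphisms between degenerate objects. -/
def degenMap {k l : SimplexCategoryᵒᵖ} (θ : k ⟶ l) {c d : Z.obj (op (.mk 0))}
    (f : degenObj Z k c ⟶ degenObj Z k d) : degenObj Z l c ⟶ degenObj Z l d :=
  eqToHom (map_degenObj Z θ c).symm ≫ (Z.map θ).toFunctor.map f ≫ eqToHom (map_degenObj Z θ d)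

theorem degenMap_id {k : SimplexCategoryᵒᵖ} {c d : Z.obj (op (.mk 0))}
    (f : degenObj Z k c ⟶ degenObj Z k d) : degenMap Z (𝟙 k) f = f := by
  have := Functor.congr_hom (congrArg Cat.Hom.toFunctor (Z.map_id k)) f
  rw [degenMap, this]
  simp

theorem degenMap_comp {k l m : SimplexCategoryᵒᵖ} (θ : k ⟶ l) (ξ : l ⟶ m)
    {c d : Z.obj (op (.mk 0))} (f : degenObj Z k c ⟶ degenObj Z k d) :
    degenMap Z (θ ≫ ξ) f = degenMap Z ξ (degenMap Z θ f) := by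
  have := Functor.congr_hom (congrArg Cat.Hom.toFunctor (Z.map_comp θ ξ)) f
  rw [degenMap, this]
  simp [degenMap, eqToHom_map]

theorem degenMap_one {k l : SimplexCategoryᵒᵖ} (θ : k ⟶ l) (c : Z.obj (op (.mk 0))) :
    degenMap Z θ (𝟙 (degenObj Z k c)) = 𝟙 (degenObj Z l c) := by
  simp [degenMap]

theorem degenMap_mul {k l : SimplexCategoryᵒᵖ} (θ : k ⟶ l) {c d e : Z.obj (op (.mk 0))}
    (f : degenObj Z k c ⟶ degenObj Z k d) (g : degenObj Z k d ⟶ degenObj Z k e) :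
    degenMap Z θ (f ≫ g) = degenMap Z θ f ≫ degenMap Z θ g := by
  simp [degenMap]

/-- The simplicial category of degenerate objects of a simplicial object in categories. -/
def ofSimplicial : SCat.{u} :=
  ofLevels (C := Z.obj (op (.mk 0)))
    (fun c d =>
      { obj k := degenObj Z k c ⟶ degenObj Z k d
        map θ := ↾(degenMap Z θ)
        map_id _ := ConcreteCategory.hom_ext _ _ fun f => degenMap_id Z f
        map_comp θ ξ := ConcreteCategory.hom_ext _ _ fun f => degenMap_comp Z θ ξ f })
    (fun k c => 𝟙 (degenObj Z k c)) (fun _ _ _ _ f g => f ≫ g)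
    (fun θ c => degenMap_one Z θ c) (fun θ _ _ _ f g => degenMap_mul Z θ f g)
    (fun _ _ _ f => Category.id_comp f) (fun _ _ _ f => Category.comp_id f)
    (fun _ _ _ _ _ f g h => Category.assoc f g h)

/-- The dimensions of `ofSimplicial Z` are the full subcategories of degenerate objects. -/
def ofSimplicialLevel (k : SimplexCategoryᵒᵖ) : Level (ofSimplicial Z) k ⥤ Z.obj k where
  obj c := degenObj Z k c
  map f := f
  map_id _ := rfl
  map_comp _ _ := rfl

instance (k : SimplexCategoryᵒᵖ) : (ofSimplicialLevel Z k).Full := ⟨fun f => ⟨f, rfl⟩⟩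

instance (k : SimplexCategoryᵒᵖ) : (ofSimplicialLevel Z k).Faithful := ⟨fun h => h⟩

theorem levelOp_ofSimplicialLevel {k l : SimplexCategoryᵒᵖ} (θ : k ⟶ l) :
    levelOp (ofSimplicial Z) θ ⋙ ofSimplicialLevel Z l =
      ofSimplicialLevel Z k ⋙ (Z.map θ).toFunctor :=
  CategoryTheory.Functor.ext (fun c => (map_degenObj Z θ c).symm) fun _ _ _ => rfl

/-- If the operators are bijective on objects, every object of `Z.obj k` is the degeneracy of a
unique object of dimension `0`. The inclusions of the full subcategories of degenerate objects are
then isomorphisms. -/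
theorem essImage_levels
    (hZ : ∀ {k l : SimplexCategoryᵒᵖ} (θ : k ⟶ l), Function.Bijective (Z.map θ).toFunctor.obj) :
    levels.{u}.essImage Z := by
  let t : levels.obj (ofSimplicial Z) ⟶ Z :=
    { app k := (ofSimplicialLevel Z k).toCatHom
      naturality k l θ := Cat.ext (levelOp_ofSimplicialLevel Z θ) }
  have (k : SimplexCategoryᵒᵖ) : IsIso (t.app k) := isIso_toCatHom_of_bijective (ofSimplicialLevel Z k) (hZ _)
  have : IsIso t := NatIso.isIso_of_isIso_app t
  exact ⟨_, ⟨asIso t⟩⟩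

end

end SCat

instance : levelsOver.{u}.Faithful where
  map_injective {S T f g} h := by
    ext1
    refine SCat.levels.map_injective (NatTrans.ext (funext fun k => ?_))
    exact congrArg (fun h => h.left) (NatTrans.congr_app h k)

instance : levelsOver.{u}.Full where
  map_surjective {S T} t := by
    let t' : SCat.levels.obj S.left ⟶ SCat.levels.obj T.left :=
      { app k := (t.app k).left
        naturality k l θ := congrArg (fun h => h.left) (t.naturality θ) }
    have h : t' ≫ SCat.levels.map T.hom = SCat.levels.map S.hom := by
      rw [← cancel_mono (SCat.discreteLevels.hom.app Ass)]
      refine NatTrans.ext (funext fun k => ?_)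
      exact Over.w (t.app k)
    refine ⟨Over.homMk (SCat.levels.preimage t') (SCat.levels.map_injective ?_), ?_⟩
    · rw [Functor.map_comp, Functor.map_preimage, h]
    · refine NatTrans.ext (funext fun k => ?_)
      ext1
      exact NatTrans.congr_app (SCat.levels.map_preimage t') k

/-- In each dimension, `sO` is given by `O`. -/
def levelsO : SCat.levels.{u} ⋙ (SimplicialObject.whiskering _ _).obj O ≅ sO ⋙ levelsOver :=
  NatIso.ofComponents (fun X => NatIso.ofComponents (fun k => Over.isoMk
    { hom := Functor.toCatHom (C := OObj (SCat.Level X k)) (D := SCat.Level (sOObj X) k)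
        { obj U := U
          map f := f
          map_id _ := rfl
          map_comp _ _ := rfl }
      inv := Functor.toCatHom (D := OObj (SCat.Level X k)) (C := SCat.Level (sOObj X) k)
        { obj U := U
          map f := f
          map_id _ := rfl
          map_comp _ _ := rfl }
      hom_inv_id := rfl
      inv_hom_id := rfl } rfl) fun _ => rfl) fun _ => rfl

end Algebroid

namespace Algebroid

/-! ### The extension -/

theorem map_restrictFullyFaithful_homEquiv {C D C' D' : Type*} [Category* C] [Category* D]
    [Category* C'] [Category* D'] {iC : C ⥤ C'} {iD : D ⥤ D'} {L' : C' ⥤ D'} {R' : D' ⥤ C'}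
    (adj : L' ⊣ R') (hiC : iC.FullyFaithful) (hiD : iD.FullyFaithful) {L : C ⥤ D} {R : D ⥤ C}
    (comm1 : iC ⋙ L' ≅ L ⋙ iD) (comm2 : iD ⋙ R' ≅ R ⋙ iC) {X : C} {Y : D} (f : L.obj X ⟶ Y) :
    iC.map ((adj.restrictFullyFaithful hiC hiD comm1 comm2).homEquiv X Y f) =
      adj.homEquiv _ _ (comm1.hom.app X ≫ iD.map f) ≫ comm2.hom.app Y := by
  rw [Adjunction.restrictFullyFaithful_homEquiv_apply, Functor.FullyFaithful.map_preimage,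
    Adjunction.homEquiv_unit]
  simp

section

variable {Fhat : Over Ass.{u} ⥤ Cat.{u, u}} (a : Fhat ⊣ O)

/-- Apply a functor in each simplicial dimension. -/
abbrev applyLevels (Fhat : Over Ass.{u} ⥤ Cat.{u, u}) :
    Over sAss.{u} ⥤ SimplicialObject Cat.{u, u} :=
  levelsOver ⋙ (SimplicialObject.whiskering _ _).obj Fhat

-- The operators of a simplicial category are the identity on objects, and `Fhat` preserves
-- bijectivity on objects.
include a in
theorem essImage_applyLevels (S : Over sAss.{u}) :
    SCat.levels.essImage ((applyLevels Fhat).obj S) :=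
  SCat.essImage_levels _ fun θ =>
    obj_bijective_of_adjunction a ((levelsOver.obj S).map θ) Function.bijective_id

/-- The functor on simplicial categories obtained by applying a left adjoint of `O` in each
simplicial dimension. -/
noncomputable def leftFunctor : Over sAss.{u} ⥤ SCat.{u} :=
  Functor.essImage.liftFunctor (applyLevels Fhat) SCat.levels (essImage_applyLevels a)

/-- The dimensions of `leftFunctor`. -/
noncomputable def leftFunctorLevels : leftFunctor a ⋙ SCat.levels ≅ applyLevels Fhat :=
  Functor.essImage.liftFunctorCompIso (applyLevels Fhat) SCat.levels (essImage_applyLevels a)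

/-- The adjunction between simplicial objects. -/
def levelsAdjunction : (SimplicialObject.whiskering _ _).obj Fhat ⊣
    (SimplicialObject.whiskering _ _).obj O :=
  a.whiskerRight SimplexCategoryᵒᵖ

theorem levelsAdjunction_homEquiv_app {Z : SimplicialObject (Over Ass.{u})}
    {W : SimplicialObject Cat.{u, u}}
    (g : ((SimplicialObject.whiskering _ _).obj Fhat).obj Z ⟶ W) (k : SimplexCategoryᵒᵖ) :
    ((levelsAdjunction a).homEquiv Z W g).app k = a.homEquiv _ _ (g.app k) := by
  rw [Adjunction.homEquiv_unit]
  refine Eq.trans ?_ (a.homEquiv_unit _ _ _).symm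
  refine congrArg (· ≫ O.map (g.app k)) ?_
  exact (Category.id_comp _).trans (Category.comp_id _)

/-- The adjunction between `leftFunctor` and `sO`. -/
noncomputable def leftAdjunction : leftFunctor a ⊣ sO :=
  Adjunction.restrictFullyFaithful (iC := levelsOver) (iD := SCat.levels)
    (levelsAdjunction a)
    (.ofFullyFaithful _) (.ofFullyFaithful _) (leftFunctorLevels a).symm levelsO

theorem levelsOver_map_leftAdjunction_homEquiv {S : Over sAss.{u}} {X : SCat.{u}}
    (f : (leftFunctor a).obj S ⟶ X) (k : SimplexCategoryᵒᵖ) :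
    (levelsOver.map ((leftAdjunction a).homEquiv S X f)).app k =
      a.homEquiv _ _ (((leftFunctorLevels a).inv.app S).app k ≫ (SCat.levels.map f).app k) ≫
        (levelsO.hom.app X).app k := by
  have h := map_restrictFullyFaithful_homEquiv (levelsAdjunction a)
    (.ofFullyFaithful _) (.ofFullyFaithful _) (leftFunctorLevels a).symm levelsO f
  refine (NatTrans.congr_app h k).trans ?_
  exact congrArg (· ≫ (levelsO.hom.app X).app k) (levelsAdjunction_homEquiv_app a _ k)

end

section

open HomotopicalAlgebra

/-- A lifting problem of `L.map f` against a trivial fibration `p` is adjoint to one of `f` against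
`sO.map p`, again a trivial fibration. A lift of the underlying simplicial functors is automatically
a lift over `sAss`. -/
theorem isQuillenAdjunction {L : Over sAss.{u} ⥤ SCat.{u}} (A : L ⊣ sO) :
    IsQuillenAdjunction A where
  left_cofibrations := by
    intro S T f hf X Y p hp
    rw [A.hasLiftingProperty_iff]
    have hf' : (trivialFibrations SCat.{u}).llp f.left := hf
    have : HasLiftingProperty f.left (sO.map p).left :=
      hf' _ ⟨sO_fibrations _ hp.1, sO_weakEquivalences _ hp.2⟩
    exact HasLiftingProperty.over _ _
  right_fibrations := sO_fibrations
  right_trivialFibrations _ _ p hp := ⟨sO_fibrations _ hp.1, sO_weakEquivalences _ hp.2⟩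

end

section

variable {F : SimplexAss.{u} ⥤ Cat.{u, u}} (adj : FormalAdjunction simplexInclusion F O.{u})
  {Fhat : Over Ass.{u} ⥤ Cat.{u, u}} (η : F ≅ simplexInclusion ⋙ Fhat) (a : Fhat ⊣ O)

theorem comp_comp_eq {C : Type*} [Category* C] {A B P Q R S T : C} {i : A ⟶ B} {h : B ⟶ A}
    {r : B ⟶ R} {p : A ⟶ P} {e : P ⟶ Q} {d : Q ⟶ R} {m : R ⟶ S} {g : Q ⟶ T} {d' : T ⟶ S}
    (h₁ : i ≫ h = 𝟙 A) (h₂ : r = h ≫ p ≫ e ≫ d) (h₃ : d ≫ m = g ≫ d') :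
    i ≫ r ≫ m = p ≫ (e ≫ g) ≫ d' := by
  subst h₂
  simp only [Category.assoc, h₃]
  rw [← Category.assoc, h₁, Category.id_comp]

theorem comp_comp_eq' {C : Type*} [Category* C] {A B P Q R : C}
    {h : A ⟶ B} {p : B ⟶ P} {e : P ⟶ Q} {d : Q ⟶ R} {d' : R ⟶ Q} {e' : Q ⟶ P}
    (h₁ : e ≫ e' = 𝟙 P) (h₂ : d ≫ d' = 𝟙 Q) :
    (h ≫ p ≫ e ≫ d) ≫ d' ≫ e' = h ≫ p := by
  simp only [Category.assoc]
  rw [← Category.assoc d, h₂, Category.id_comp, h₁, Category.comp_id]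

theorem discreteOverLevel_inv_naturality (S : Over Ass.{u}) {k l : SimplexCategoryᵒᵖ} (θ : k ⟶ l) :
    (levelsOver.obj (discreteOver.obj S)).map θ ≫ (discreteOverLevel S l).inv =
      (discreteOverLevel S k).inv := by
  ext1
  rfl

theorem discreteOverLevel_inv_naturality' {S T : Over Ass.{u}} (f : S ⟶ T)
    (k : SimplexCategoryᵒᵖ) :
    (levelsOver.map (discreteOver.map f)).app k ≫ (discreteOverLevel T k).inv =
      (discreteOverLevel S k).inv ≫ f := by
  ext1
  rfl

/-- Applying a functor to a discrete simplicial category over `Ass`. -/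
def applyLevelsDiscrete (Fhat : Over Ass.{u} ⥤ Cat.{u, u}) :
    discreteOver ⋙ applyLevels Fhat ≅ Fhat ⋙ Functor.const _ :=
  NatIso.ofComponents (fun S => NatIso.ofComponents
    (fun k => (Fhat.mapIso (discreteOverLevel S k)).symm)
    fun {k l} θ => by
      refine Eq.trans ?_ (Category.comp_id _).symm
      exact (Fhat.map_comp _ _).symm.trans
        (congrArg Fhat.map (discreteOverLevel_inv_naturality S θ)))
    fun {S T} f => by
      refine NatTrans.ext (funext fun k => ?_)
      exact (Fhat.map_comp _ _).symm.trans
        ((congrArg Fhat.map (discreteOverLevel_inv_naturality' f k)).trans (Fhat.map_comp _ _))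

/-- The restriction of `leftFunctor` to the simplices of `Ass`, as simplicial objects. -/
noncomputable def leftRestrictionLevels :
    (simplexInclusion ⋙ discreteOver ⋙ leftFunctor a) ⋙ SCat.levels ≅
      (F ⋙ SCat.discrete) ⋙ SCat.levels :=
  Functor.isoWhiskerLeft (simplexInclusion ⋙ discreteOver) (leftFunctorLevels a) ≪≫
    Functor.isoWhiskerLeft simplexInclusion (applyLevelsDiscrete Fhat) ≪≫
    Functor.isoWhiskerRight η.symm (Functor.const SimplexCategoryᵒᵖ) ≪≫
    Functor.isoWhiskerLeft F SCat.discreteLevels.symm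

/-- The restriction of `leftFunctor` to the simplices of `Ass`. -/
noncomputable def leftRestriction :
    simplexInclusion ⋙ discreteOver ⋙ leftFunctor a ≅ F ⋙ SCat.discrete :=
  ((Functor.FullyFaithful.ofFullyFaithful SCat.levels).whiskeringRight _).preimageIso
    (leftRestrictionLevels η a)

theorem levels_map_leftRestriction (σ : SimplexAss.{u}) (k : SimplexCategoryᵒᵖ) :
    (SCat.levels.map ((leftRestriction η a).hom.app σ)).app k =
      ((leftFunctorLevels a).hom.app (discreteOver.obj (simplexInclusion.obj σ))).app k ≫
        Fhat.map (discreteOverLevel (simplexInclusion.obj σ) k).inv ≫ η.inv.app σ ≫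
          (SCat.discreteLevels.inv.app (F.obj σ)).app k := by
  have h := ((Functor.FullyFaithful.ofFullyFaithful SCat.levels).whiskeringRight
    SimplexAss.{u}).map_preimage (leftRestrictionLevels η a).hom
  exact NatTrans.congr_app (NatTrans.congr_app h σ) k

/-- The extension of a formal adjunction. -/
noncomputable def leftExtension
    (ha : ∀ (T : Over Ass.{u}) (X : Cat.{u, u}) (k : Fhat.obj T ⟶ X) (c : SimplexAss.{u})
      (x : simplexInclusion.obj c ⟶ T),
      x ≫ a.homEquiv T X k = adj.homEquiv c X (η.hom.app c ≫ Fhat.map x ≫ k)) :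
    Extension adj where
  functor := leftFunctor a
  restriction := leftRestriction η a
  adjunction := leftAdjunction a
  extends_adj σ X g := by
    apply levelsOver.map_injective
    refine NatTrans.ext (funext fun k => ?_)
    have h₁ : ((leftFunctorLevels a).inv.app (discreteOver.obj (simplexInclusion.obj σ))).app k ≫
        (SCat.levels.map ((leftRestriction η a).hom.app σ ≫ SCat.discrete.map g)).app k =
        Fhat.map (discreteOverLevel (simplexInclusion.obj σ) k).inv ≫ (η.inv.app σ ≫ g) ≫
          (SCat.discreteLevels.inv.app X).app k := by
      have h := NatTrans.congr_app (SCat.discreteLevels.inv.naturality g) k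
      have h' := NatTrans.congr_app ((leftFunctorLevels a).inv_hom_id_app
        (discreteOver.obj (simplexInclusion.obj σ))) k
      exact comp_comp_eq h' (levels_map_leftRestriction η a σ k) h.symm
    -- This is `ha` evaluated at the identity of the simplex `σ`.
    have h₂ : a.homEquiv _ _ (η.inv.app σ ≫ g) = adj.homEquiv σ X g := by
      refine (Category.id_comp _).symm.trans ((ha _ _ _ σ (𝟙 _)).trans (congrArg _ ?_))
      simp
    rw [levelsOver_map_leftAdjunction_homEquiv]
    refine (congrArg (fun z => a.homEquiv _ _ z ≫ (levelsO.hom.app _).app k) h₁).trans ?_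
    rw [a.homEquiv_naturality_left, a.homEquiv_naturality_right, h₂]
    ext1
    rfl

theorem leftExtension_levelwise
    (ha : ∀ (T : Over Ass.{u}) (X : Cat.{u, u}) (k : Fhat.obj T ⟶ X) (c : SimplexAss.{u})
      (x : simplexInclusion.obj c ⟶ T),
      x ≫ a.homEquiv T X k = adj.homEquiv c X (η.hom.app c ≫ Fhat.map x ≫ k)) :
    Nonempty ((leftExtension adj η a ha).Levelwise η.hom) := by
  refine ⟨⟨leftFunctorLevels a, fun σ k => ?_⟩⟩
  refine (congrArg (· ≫ (SCat.discreteLevels.hom.app (F.obj σ)).app k ≫ η.hom.app σ)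
    (levels_map_leftRestriction η a σ k)).trans ?_
  have h := NatTrans.congr_app (SCat.discreteLevels.inv_hom_id_app (F.obj σ)) k
  exact comp_comp_eq' (η.inv_hom_id_app σ) h

end

end Algebroid

/-! ### Rigidity of `sO` and uniqueness of the extension. -/

namespace Algebroid

/-! ### Simplicial categories whose simplices are determined by their vertices -/

/-- The simplices of morphisms of a simplicial category are determined by their vertices. -/
def SCat.VertexDetermined (Y : SCat.{u}) : Prop :=
  ∀ (l : SimplexCategoryᵒᵖ) (a b : Level Y l) (f g : a ⟶ b),
    (∀ v : l ⟶ op (.mk 0), (levelOp Y v).map f = (levelOp Y v).map g) → f = g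

/-- A vertex of the standard simplex. -/
def vertex (l : SimplexCategoryᵒᵖ) (i : Fin (l.unop.len + 1)) : l ⟶ op (.mk 0) :=
  (SimplexCategory.const (.mk 0) l.unop i).op

theorem eq_of_comp_vertex {k l : SimplexCategoryᵒᵖ} {φ ψ : k ⟶ l}
    (h : ∀ v : l ⟶ op (.mk 0), φ ≫ v = ψ ≫ v) : φ = ψ := by
  apply Quiver.Hom.unop_inj
  ext i : 3
  have := congrArg (fun χ => χ.unop.toOrderHom 0) (h (vertex l i))
  exact this

theorem Str.eq_of_vertices {Y : SCat.{u}} (hY : Y.VertexDetermined) (l : SimplexCategoryᵒᵖ) {m : ℕ}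
    {u : Fin m → SCat.Level Y l × SCat.Level Y l} {a b : Fin (m + 1)} {c d : SCat.Level Y l}
    (s t : Str u a b c d) (h : ∀ v : l ⟶ op (.mk 0),
      Str.map (SCat.levelOp Y v) s = Str.map (SCat.levelOp Y v) t) : s = t := by
  induction s with
  | last f =>
    obtain ⟨g, rfl⟩ := (last_bijective _ _ _).2 t
    exact congrArg Str.last (hY l _ _ f g fun v => (last_bijective _ _ _).1 (h v))
  | cons i f s ih =>
    have hi := ne_of_gt (Fin.castSucc_lt_succ.trans_le s.le)
    obtain ⟨⟨g, t⟩, rfl⟩ := (cons_bijective (u := u) i _ hi _ _).2 t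
    have h' (v : l ⟶ op (.mk 0)) := (cons_bijective i _ hi _ _).1
      (a₁ := ((SCat.levelOp Y v).map f, Str.map (SCat.levelOp Y v) s))
      (a₂ := ((SCat.levelOp Y v).map g, Str.map (SCat.levelOp Y v) t)) (h v)
    exact congrArg₂ (Str.cons i) (hY l _ _ f g fun v => congrArg Prod.fst (h' v))
      (ih t fun v => congrArg Prod.snd (h' v))

theorem vertexDetermined_sOObj {Y : SCat.{u}} (hY : Y.VertexDetermined) :
    (sOObj Y).VertexDetermined := by
  intro l U V f g h
  change OHom (C := SCat.Level Y l) U V at f g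
  have h' (v : l ⟶ op (.mk 0)) : opMap Y v f = opMap Y v g := h v
  obtain ⟨φ, s⟩ := f
  obtain ⟨ψ, t⟩ := g
  -- Simplicial operators do not change the base, so any vertex can be used to compare the bases.
  obtain rfl : φ = ψ := congrArg OHom.base (h' (vertex l 0))
  refine congrArg (OHom.mk φ) (funext fun i => Str.eq_of_vertices hY l _ _ fun v => ?_)
  have := eq_of_heq (OHom.mk.inj (h' v)).2
  exact congrFun this i

/-- A simplex and its image under `B` have the same vertices, because `B` commutes with the
operators to dimension `0` and is trivial there. -/
theorem levelMap_eq_id_of_vertexDetermined {Y : SCat.{u}} (hY : Y.VertexDetermined) (B : Y ⟶ Y)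
    (hB : SCat.levelMap B (op (.mk 0)) = 𝟭 _) (l : SimplexCategoryᵒᵖ) :
    SCat.levelMap B l = 𝟭 _ := by
  have hobj (a : SCat.Level Y l) : (SCat.levelMap B l).obj a = a := Functor.congr_obj hB a
  refine CategoryTheory.Functor.ext hobj fun a b f => ?_
  refine hY l _ _ _ _ fun v => ?_
  have h := Functor.congr_hom (SCat.levelOp_levelMap B v) f
  have h' := Functor.congr_hom hB ((SCat.levelOp Y v).map f)
  rw [Functor.map_comp, Functor.map_comp, eqToHom_map, eqToHom_map]
  refine Eq.trans ?_ h'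
  exact (h.trans ((Category.id_comp _).trans (Category.comp_id _))).symm

/-! ### A simplicial category which represents simplices of morphisms -/

/-- The morphisms, in dimension `l`, of the free simplicial category with two copies of the objects
of `X` and, for every `k`-simplex of the morphisms from `c` to `d`, a `k`-simplex from the first
copy of `c` to the second copy of `d`. -/
inductive BipHom (X : SCat.{u}) (k l : SimplexCategoryᵒᵖ) :
    X.carrier ⊕ X.carrier → X.carrier ⊕ X.carrier → Type u
  | id (a) : BipHom X k l a a
  | arr {c d : X.carrier} (x : (X.str.Hom c d).obj k) (φ : k ⟶ l) :
      BipHom X k l (.inl c) (.inr d)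

namespace BipHom

variable {X : SCat.{u}} {k l m : SimplexCategoryᵒᵖ}

/-- Composition of morphisms. -/
def comp {a b c : X.carrier ⊕ X.carrier} : BipHom X k l a b → BipHom X k l b c → BipHom X k l a c
  | id _, g => g
  | arr x φ, id _ => arr x φ

/-- The action of simplicial operators. -/
def op (θ : l ⟶ m) {a b : X.carrier ⊕ X.carrier} : BipHom X k l a b → BipHom X k m a b
  | id a => id a
  | arr x φ => arr x (φ ≫ θ)

/-- The evaluation of morphisms in `X`. -/
def eval {a b : X.carrier ⊕ X.carrier} : BipHom X k l a b →
    (X.str.Hom (Sum.elim _root_.id _root_.id a) (Sum.elim _root_.id _root_.id b)).obj l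
  | id a => 𝟙 (show SCat.Level X l from Sum.elim _root_.id _root_.id a)
  | arr x φ => (X.str.Hom _ _).map φ x

/-- The evaluation of morphisms, as morphisms of the category of simplices. -/
abbrev hom {a b : X.carrier ⊕ X.carrier} (f : BipHom X k l a b) :
    @Quiver.Hom (SCat.Level X l) _ (Sum.elim _root_.id _root_.id a)
      (Sum.elim _root_.id _root_.id b) :=
  eval f

end BipHom

/-- The free simplicial category on two copies of the objects of `X` and the `k`-simplices of
morphisms of `X`. -/
def bip (X : SCat.{u}) (k : SimplexCategoryᵒᵖ) : SCat.{u} :=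
  SCat.ofLevels (C := X.carrier ⊕ X.carrier)
    (fun a b =>
      { obj l := BipHom X k l a b
        map θ := ↾(BipHom.op θ)
        map_id l := ConcreteCategory.hom_ext _ _ fun f => by
          cases f with
          | id => rfl
          | arr x φ => exact congrArg (BipHom.arr x) (Category.comp_id φ)
        map_comp θ ξ := ConcreteCategory.hom_ext _ _ fun f => by
          cases f with
          | id => rfl
          | arr x φ => exact congrArg (BipHom.arr x) (Category.assoc φ θ ξ).symm })
    (fun _ a => BipHom.id a) (fun _ _ _ _ f g => BipHom.comp f g)
    (fun _ _ => rfl) (fun _ _ _ _ f g => by cases f <;> cases g <;> rfl)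
    (fun _ _ _ _ => rfl) (fun _ _ _ f => by cases f <;> rfl)
    (fun _ _ _ _ _ f g h => by cases f <;> cases g <;> cases h <;> rfl)

/-- With sources and targets in different copies, there are no composites except with identities.
Nonidentity simplices are pairs of a generator and an operator, and an operator is determined by its
effect on vertices. -/
theorem vertexDetermined_bip (X : SCat.{u}) (k : SimplexCategoryᵒᵖ) :
    (bip X k).VertexDetermined := by
  intro l a b f g h
  change BipHom X k l a b at f g
  have h' (v : l ⟶ op (.mk 0)) : BipHom.op v f = BipHom.op v g := h v
  cases f with
  | id =>
    cases g
    rfl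
  | arr x φ =>
    cases g with
    | arr y ψ =>
      obtain rfl : x = y := (BipHom.arr.inj (h' (vertex l 0))).1
      exact congrArg _ (eq_of_comp_vertex fun v => (BipHom.arr.inj (h' v)).2)

/-- The evaluation functor to `X`. -/
def bipEval (X : SCat.{u}) (k : SimplexCategoryᵒᵖ) : bip X k ⟶ X where
  obj := Sum.elim id id
  map a b :=
    { app l := ↾BipHom.eval
      naturality l m θ := ConcreteCategory.hom_ext _ _ fun f => by
        cases f with
        | id a => exact ((SCat.levelOp X θ).map_id _).symm
        | arr x φ => exact ConcreteCategory.congr_hom ((X.str.Hom _ _).map_comp φ θ) x }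
  map_id a := rfl
  map_comp a b c := by
    ext l ⟨f, g⟩
    change BipHom X k l a b at f
    change BipHom X k l b c at g
    cases f with
    | id => exact (Category.id_comp (BipHom.hom g)).symm
    | arr x φ =>
      cases g
      exact (Category.comp_id (BipHom.hom (BipHom.arr x φ))).symm

section

variable {X : SCat.{u}} {k : SimplexCategoryᵒᵖ}

/-- The morphism of `bip X k` attached to a `k`-simplex. -/
def bipArr {c d : SCat.Level X k} (x : c ⟶ d) :
    @Quiver.Hom (SCat.Level (bip X k) k) _ (Sum.inl c) (Sum.inr d) :=
  BipHom.arr x (𝟙 k)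

/-- The source of the lift of a morphism of operators. -/
def bipSource {m : ℕ} (u : Fin m → SCat.Level X k × SCat.Level X k) (i : Fin m) :
    SCat.Level (bip X k) k × SCat.Level (bip X k) k :=
  (Sum.inr (u i).1, Sum.inl (u i).2)

/-- The lift of a string to `bip X k`. -/
def bipStr {m : ℕ} {u : Fin m → SCat.Level X k × SCat.Level X k} {a b : Fin (m + 1)}
    {c d : SCat.Level X k} : Str u a b c d → Str (bipSource u) a b (Sum.inl c) (Sum.inr d)
  | .last f => .last (bipArr f)
  | .cons i f t => .cons i (bipArr f) (bipStr t)

theorem map_bipArr {c d : SCat.Level X k} (x : c ⟶ d) :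
    (SCat.levelMap (bipEval X k) k).map (bipArr x) = x :=
  ConcreteCategory.congr_hom ((X.str.Hom c d).map_id k) x

theorem map_bipStr {m : ℕ} {u : Fin m → SCat.Level X k × SCat.Level X k} {a b : Fin (m + 1)}
    {c d : SCat.Level X k} (s : Str u a b c d) :
    Str.map (SCat.levelMap (bipEval X k) k) (bipStr s) = s := by
  induction s with
  | last f => exact congrArg Str.last (map_bipArr f)
  | cons i f t ih => exact congrArg₂ (Str.cons i) (map_bipArr f) ih

/-- The lift of a morphism of operators to `bip X k`. -/
def bipLift {U V : OObj X.carrier} (f : OHom (C := SCat.Level X k) U V) :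
    OHom (C := SCat.Level (bip X k) k) ⟨U.len, bipSource U.seq⟩
      ⟨V.len, fun i => (Sum.inl (V.seq i).1, Sum.inr (V.seq i).2)⟩ :=
  ⟨f.base, fun i => bipStr (f.str i)⟩

/-- Each morphism of a string starts at an end `c` or at a second member of a pair, and ends at a
first member or at `d`. Placing sources in the left copy and targets in the right copy therefore
lifts all of them to generators simultaneously. -/
theorem map_bipLift {U V : OObj X.carrier} (f : OHom (C := SCat.Level X k) U V) :
    OHom.map (SCat.levelMap (bipEval X k) k) (bipLift f) = f :=
  congrArg (OHom.mk f.base) (funext fun i => map_bipStr (f.str i))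

end

/-! ### Endomorphisms of `sO` -/

/-- On `sO (bip X k)` the transformation is trivial, as simplices there are determined by vertices.
Naturality along `bipEval X k` carries this to every `k`-simplex `f`, which is the image of `bipLift
f`. -/
theorem levelMap_eq_id_of_natTrans (β : (sO.{u} ⟶ sO.{u}))
    (h₀ : ∀ X, SCat.levelMap (β.app X).left (op (.mk 0)) = 𝟭 _) (X : SCat.{u})
    (k : SimplexCategoryᵒᵖ) : SCat.levelMap (β.app X).left k = 𝟭 _ := by
  have hobj (U : SCat.Level (sOObj X) k) : (SCat.levelMap (β.app X).left k).obj U = U :=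
    Functor.congr_obj (h₀ X) U
  refine CategoryTheory.Functor.ext hobj fun U V f => ?_
  have h := congrArg (fun g => SCat.levelMap (CommaMorphism.left g) k) (β.naturality (bipEval X k))
  have h' : SCat.levelMap (sOMap (bipEval X k)) k ⋙ SCat.levelMap (β.app X).left k =
      SCat.levelMap (sOMap (bipEval X k)) k := by
    refine h.trans ?_
    refine (congrArg (· ⋙ SCat.levelMap (sOMap (bipEval X k)) k)
      (levelMap_eq_id_of_vertexDetermined (vertexDetermined_sOObj (vertexDetermined_bip X k))
        (β.app (bip X k)).left (h₀ _) k)).trans rfl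
  have h'' := Functor.congr_hom h' (bipLift f)
  have e : (SCat.levelMap (sOMap (bipEval X k)) k).map (bipLift f) = f := map_bipLift f
  exact (congrArg (SCat.levelMap (β.app X).left k).map e).symm.trans
    (h''.trans (congrArg (fun z => eqToHom (hobj U) ≫ z ≫ eqToHom (hobj V).symm) e))

/-- The simplicial functor on a discrete simplicial category attached to a functor. -/
def ofDiscrete {C : Cat.{u, u}} {Y : SCat.{u}} (K : C ⥤ SCat.Level Y (op (.mk 0))) :
    SCat.discrete.obj C ⟶ Y where
  obj := K.obj
  map a b :=
    { app k := ↾fun f => (SCat.levelOp Y (fromZero k)).map (K.map (X := a) (Y := b) f)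
      naturality k l θ := ConcreteCategory.hom_ext _ _ fun f => by
        have h : SCat.levelOp Y (fromZero l) =
            SCat.levelOp Y (fromZero k) ⋙ SCat.levelOp Y θ := by
          rw [← SCat.levelOp_comp, fromZero_comp]
        exact (Functor.congr_hom h (K.map (X := a) (Y := b) f)).trans
          ((Category.id_comp _).trans (Category.comp_id _)) }
  map_id a := by
    ext k x
    exact (K ⋙ SCat.levelOp Y (fromZero k)).map_id a
  map_comp a b c := by
    ext k ⟨f, g⟩
    exact (K ⋙ SCat.levelOp Y (fromZero k)).map_comp f g

theorem levelMap_ofDiscrete {C : Cat.{u, u}} {Y : SCat.{u}}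
    (K : C ⥤ SCat.Level Y (op (.mk 0))) :
    SCat.toDiscreteLevel C _ ⋙ SCat.levelMap (ofDiscrete K) (op (.mk 0)) = K := by
  have h : SCat.levelOp Y (fromZero (op (.mk 0))) = 𝟭 _ :=
    (congrArg (SCat.levelOp Y) (Quiver.Hom.unop_inj
      (SimplexCategory.isTerminalZero.hom_ext _ _))).trans (SCat.levelOp_id Y _)
  exact congrArg (K ⋙ ·) h

theorem eq_id_of_composableArrows {C : Type*} [Category* C] (B : C ⥤ C)
    (h : ∀ K : ComposableArrows C 1, K ⋙ B = K) : B = 𝟭 C := by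
  have hobj (U : C) : B.obj U = U := Functor.congr_obj (h (ComposableArrows.mk₁ (𝟙 U))) 0
  refine CategoryTheory.Functor.ext hobj fun U V f => ?_
  have := Functor.congr_hom (h (ComposableArrows.mk₁ f)) (homOfLE (Fin.zero_le 1))
  exact this

/-- A morphism in dimension `0` of `sO X` is a functor from `{0, 1}`. Composed with the projection
to `Ass`, it becomes a map over `Ass` from a `1`-simplex `σ`, to which the hypothesis applies. -/
theorem levelMap_zero_eq_id (β : sO.{u} ⟶ sO.{u})
    (h : ∀ (σ : SimplexAss.{u}) (X : SCat.{u})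
      (g : discreteOver.obj (simplexInclusion.obj σ) ⟶ sO.obj X), g ≫ β.app X = g)
    (X : SCat.{u}) : SCat.levelMap (β.app X).left (op (.mk 0)) = 𝟭 _ := by
  have key (K : ComposableArrows (SCat.Level (sOObj X) (op (.mk 0))) 1) :
      K ⋙ SCat.levelMap (β.app X).left (op (.mk 0)) = K := by
    let K' : simplex.{u}.obj (.mk 1) ⥤ SCat.Level (sOObj X) (op (.mk 0)) :=
      Functor.comp (C := AsSmall.{u} (Fin 2)) AsSmall.down K
    let p : SCat.Level (sOObj X) (op (.mk 0)) ⥤ Ass.{u} :=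
      SCat.levelMap (sOProj X) _ ⋙ SCat.ofDiscreteLevel Ass _
    let s : simplex.{u}.obj (.mk 1) ⟶ Ass.{u} := (K' ⋙ p).toCatHom
    let σ : SimplexAss.{u} := CostructuredArrow.mk s
    let g : discreteOver.obj (simplexInclusion.obj σ) ⟶ sO.obj X :=
      Over.homMk (ofDiscrete K') rfl
    have hg : SCat.levelMap (ofDiscrete K' ≫ (β.app X).left) (op (.mk 0)) =
        SCat.levelMap (ofDiscrete K') (op (.mk 0)) :=
      congrArg (fun g => SCat.levelMap (CommaMorphism.left g) (op (.mk 0))) (h σ X g)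
    have hK := levelMap_ofDiscrete K'
    have h' : K' ⋙ SCat.levelMap (β.app X).left (op (.mk 0)) = K' :=
      (congrArg (· ⋙ SCat.levelMap (β.app X).left (op (.mk 0))) hK).symm.trans
        ((congrArg (SCat.toDiscreteLevel _ _ ⋙ ·) hg).trans hK)
    exact congrArg (Functor.comp (D := AsSmall.{u} (Fin 2)) AsSmall.up) h'
  exact eq_id_of_composableArrows _ key

theorem natTrans_eq_id (β : sO.{u} ⟶ sO.{u})
    (h : ∀ (σ : SimplexAss.{u}) (X : SCat.{u})
      (g : discreteOver.obj (simplexInclusion.obj σ) ⟶ sO.obj X), g ≫ β.app X = g) : β = 𝟙 _ := by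
  refine NatTrans.ext (funext fun X => ?_)
  ext1
  refine SCat.levels.map_injective (NatTrans.ext (funext fun k => Cat.ext ?_))
  exact levelMap_eq_id_of_natTrans β (levelMap_zero_eq_id β h) X k

/-! ### Uniqueness of extensions -/

namespace Extension

variable {F : SimplexAss.{u} ⥤ Cat.{u, u}} {adj : FormalAdjunction simplexInclusion F O.{u}}
  {E E' : Extension adj}

theorem RespectsAdjunction.eq {θ θ' : E.functor ≅ E'.functor} (h : RespectsAdjunction θ)
    (h' : RespectsAdjunction θ') : θ = θ' := by
  ext1
  refine NatTrans.ext (funext fun S => (E.adjunction.homEquiv _ _).injective ?_)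
  have e := h S _ (𝟙 _)
  have e' := h' S _ (𝟙 _)
  rw [Category.comp_id] at e e'
  exact e.trans e'.symm

theorem homEquiv_restriction (E : Extension adj) (σ : SimplexAss.{u}) :
    E.adjunction.homEquiv _ _ (E.restriction.hom.app σ) =
      discreteOver.map (adj.homEquiv σ _ (𝟙 _)) ≫ discreteO.hom.app (F.obj σ) := by
  rw [← E.extends_adj, CategoryTheory.Functor.map_id]
  exact congrArg _ (Category.comp_id _).symm

/-- Both restrictions have the same adjunct, prescribed by `adj` at the identity of `F.obj σ`. -/
theorem RespectsAdjunction.respectsRestriction {θ : E.functor ≅ E'.functor}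
    (h : RespectsAdjunction θ) : RespectsRestriction θ := by
  intro σ
  refine (E.adjunction.homEquiv _ _).injective ?_
  exact (h _ _ _).trans ((homEquiv_restriction E' σ).trans (homEquiv_restriction E σ).symm)

variable (E E') in
/-- The isomorphism between two extensions. -/
def uniq : E.functor ≅ E'.functor := E.adjunction.leftAdjointUniq E'.adjunction

variable (E E') in
theorem respectsAdjunction_uniq : RespectsAdjunction (uniq E E') := by
  intro S X g
  rw [Adjunction.homEquiv_naturality_right, uniq, Adjunction.homEquiv_leftAdjointUniq_hom_app,
    Adjunction.homEquiv_unit]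

/-- Let `β` be the conjugate of `τ`. Precomposing with `τ` corresponds to postcomposing with `β`, so
`β` fixes all maps from simplices to `sO X` and `natTrans_eq_id` applies. -/
theorem eq_id_of_restriction (E : Extension adj) (τ : E.functor ⟶ E.functor)
    (h : ∀ σ, τ.app (discreteOver.obj (simplexInclusion.obj σ)) = 𝟙 _) : τ = 𝟙 _ := by
  let β : sO.{u} ⟶ sO.{u} := conjugateEquiv E.adjunction E.adjunction τ
  have hβ {S : Over sAss.{u}} {X : SCat.{u}} (g : E.functor.obj S ⟶ X) :
      E.adjunction.homEquiv _ _ (τ.app S ≫ g) = E.adjunction.homEquiv _ _ g ≫ β.app X := by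
    have e := unit_conjugateEquiv E.adjunction E.adjunction τ S
    rw [Adjunction.homEquiv_unit, Adjunction.homEquiv_unit, Functor.map_comp, ← Category.assoc,
      ← e, Category.assoc, Category.assoc]
    exact congrArg (E.adjunction.unit.app S ≫ ·) (β.naturality g).symm
  have hβ' : β = 𝟙 _ := natTrans_eq_id β fun σ X g => by
    obtain ⟨g, rfl⟩ := (E.adjunction.homEquiv _ _).surjective g
    rw [← hβ, h, Category.id_comp]
  refine NatTrans.ext (funext fun S => (E.adjunction.homEquiv _ _).injective ?_)
  have := hβ (𝟙 (E.functor.obj S))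
  rw [hβ', Category.comp_id] at this
  exact this.trans (Category.comp_id _)

theorem RespectsRestriction.eq {θ θ' : E.functor ≅ E'.functor} (h : RespectsRestriction θ)
    (h' : RespectsRestriction θ') : θ = θ' := by
  -- The composite `θ.hom ≫ θ'.inv` is an endomorphism of the left adjoint, trivial on simplices.
  have := eq_id_of_restriction E (θ.hom ≫ θ'.inv) fun σ => by
    have e : θ.hom.app _ = θ'.hom.app _ :=
      (cancel_mono (E'.restriction.hom.app σ)).1 ((h σ).trans (h' σ).symm)
    rw [NatTrans.comp_app, e]
    exact θ'.hom_inv_id_app _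
  ext1
  rwa [Iso.comp_inv_eq, Category.id_comp] at this

end Extension

end Algebroid

theorem mainTheorem4 (F : Algebroid.SimplexAss.{u} ⥤ Cat.{u, u})
    (adj : Algebroid.FormalAdjunction Algebroid.simplexInclusion F Algebroid.O.{u}) :
    -- `sO` preserves fibrations and weak equivalences
    (HomotopicalAlgebra.fibrations Algebroid.SCat.{u} ≤
      (HomotopicalAlgebra.fibrations (Over Algebroid.sAss.{u})).inverseImage Algebroid.sO) ∧
    (HomotopicalAlgebra.weakEquivalences Algebroid.SCat.{u} ≤
      (HomotopicalAlgebra.weakEquivalences (Over Algebroid.sAss.{u})).inverseImage Algebroid.sO) ∧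
    -- the left Kan extension `Fhat` of `F` exists
    Algebroid.simplexInclusion.{u}.HasPointwiseLeftKanExtension F ∧
    ∀ (Fhat : Over Algebroid.Ass.{u} ⥤ Cat.{u, u}) (η : F ⟶ Algebroid.simplexInclusion ⋙ Fhat),
      Fhat.IsLeftKanExtension η →
      -- an extension of `adj` exists, is given by `Fhat` in each dimension, is Quillen
      ∃ E : Algebroid.Extension adj, Nonempty (E.Levelwise η) ∧
        Algebroid.IsQuillenAdjunction E.adjunction ∧
        -- and is unique up to a unique isomorphism
        ∀ E' : Algebroid.Extension adj, ∃ θ : E.functor ≅ E'.functor,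
          Algebroid.Extension.RespectsRestriction θ ∧
          Algebroid.Extension.RespectsAdjunction θ ∧
          (∀ θ' : E.functor ≅ E'.functor,
            Algebroid.Extension.RespectsRestriction θ' → θ' = θ) ∧
          (∀ θ' : E.functor ≅ E'.functor,
            Algebroid.Extension.RespectsAdjunction θ' → θ' = θ) := by
  refine ⟨Algebroid.sO_fibrations, Algebroid.sO_weakEquivalences, inferInstance,
    fun Fhat η hF => ?_⟩
  -- Since a pointwise Kan extension exists, every left Kan extension is pointwise.
  have hL := Functor.isPointwiseLeftKanExtensionOfIsLeftKanExtension Fhat η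
  obtain ⟨a, ha⟩ := adj.exists_adjunction hL fun T => (Algebroid.denseAt_simplexInclusion T).some
  have : IsIso η := hL.isIso_hom
  let E := Algebroid.leftExtension adj (asIso η) a ha
  refine ⟨E, Algebroid.leftExtension_levelwise adj (asIso η) a ha,
    Algebroid.isQuillenAdjunction _, fun E' => ⟨Algebroid.Extension.uniq E E', ?_⟩⟩
  have h := Algebroid.Extension.respectsAdjunction_uniq E E'
  exact ⟨h.respectsRestriction, h, fun θ' h' => h'.eq h.respectsRestriction,
    fun θ' h' => h'.eq h⟩
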